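/- **Definitions.** A garden-hose protocol of size $s$ for inputs in $\mathcal X\times\mathcal Y$ consists of a set $V$ of $s$ vertices (the pipes), an extra vertex $t\notin V$ (the tap), a map assigning to each $x\in\mathcal X$ a matching $E_A(x)$ on $V\cup\{t\}$, and a map assigning to each $y\in\mathcal Y$ a matching $E_B(y)$ on $V$. Its output on $(x,y)$ is the parity of the length of the path that starts at $t$ in $E_A(x)\cup E_B(y)$. $GH(f)$ is the least size of a protocol whose output is $f(x,y)$ for all $(x,y)$. A Boolean formula is a tree whose leaves are labelled by variables or by constants $0,1$ and whose inner nodes are labelled by gate functions of positive fan-in; its size is its number of leaves. $L_2(g)$ denotes the least size of a formula for $g$ over all $16$ gates of fan-in $2$. If $g$ is a Boolean function of $n$ variables and $A$ is a set of its variables, $GH_A(g)$ denotes the garden-hose complexity of $g$ when Alice holds the variables in $A$ and Bob holds all the others. **Theorem.** 1. For every $\varepsilon>0$ there is a constant $C=C(\varepsilon)>0$ such that the following holds. Let $F$ be a formula of size $s$, made of AND, OR and XOR gates of arbitrary positive fan-in, for a Boolean function $g:\{0,1\}^k\to\{0,1\}$. Let $f_1,\dots,f_k:\mathcal X\times\mathcal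 Y\to\{0,1\}$ satisfy $GH(f_i)\le c$ for all $i$, where $c\ge 0$ is an integer, and $c\ge 1$ if $F$ has a leaf labelled by a constant. Then $$GH(g(f_1,\dots,f_k))\le C\,s^{1+\varepsilon}\,c .$$ 2. For every $\varepsilon>0$ there is a constant $C=C(\varepsilon)>0$ such that, for all $n$, every $g:\{0,1\}^n\to\{0,1\}$ that has a formula of size $s$ over all gates of fan-in $2$, and every set $A$ of variables, $GH_A(g)\le C\,s^{1+\varepsilon}$. 3. Hence any lower bound on garden-hose complexity yields a slightly smaller lower bound on formula size: for every $\delta\in(0,1)$ there is a constant $b=b(\delta)>0$ such that, for all $n$, $g:\{0,1\}^n\to\{0,1\}$, $A$ and real $t\ge 0$, if $GH_A(g)\ge t$ then $L_2(g)\ge b\,t^{1-\delta}$. 4. In particular, let $0<\delta<\varepsilon$, let $(g_n)_{n\in\mathbb N}$ be a sequence of Boolean functions (of $m(n)$ variables, $m$ arbitrary), and let $A_n$ be a set of variables of $g_n$. If $GH_{A_n}(g_n)=\Omega(n^{2+\varepsilon})$, then $L_2(g_n)=\Omega(n^{2+\delta})$. -/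

import Mathlib

namespace GardenHose

/-- A matching on a vertex set `V`: every vertex is joined to at most one other vertex.
`partner u = some v` says that `{u, v}` is an edge, `partner u = none` that `u` is unmatched. -/
structure Matching (V : Type) where
  partner : V → Option V
  symm : ∀ u v, partner u = some v → partner v = some u
  irrefl : ∀ u, partner u ≠ some u

/-- A garden-hose protocol with `s` pipes. The pipes are the vertices `Fin s`; on Alice's side there
is one extra vertex, the tap, so that her vertex set is `Option (Fin s)` with the tap `none`. -/
structure Protocol (X Y : Type*) (s : ℕ) where
  alice : X → Matching (Option (Fin s))
  bob : Y → Matching (Fin s)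

/-- The path that starts at the tap in the union of the two matchings: `water MA MB n` is the vertex
reached after `n` edges, or `none` if the path has fewer than `n` edges. As both edge sets are
matchings and the tap only belongs to Alice, the edges alternate, Alice's being the first. -/
def water {s : ℕ} (MA : Matching (Option (Fin s))) (MB : Matching (Fin s)) :
    ℕ → Option (Option (Fin s))
  | 0 => some none
  | n + 1 => (water MA MB n).bind fun u =>
      if Even n then MA.partner u else (u.bind MB.partner).map some

/-- The path from the tap has exactly `n` edges. -/
def IsPathLength {s : ℕ} (MA : Matching (Option (Fin s))) (MB : Matching (Fin s)) (n : ℕ) : Prop :=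
  (water MA MB n).isSome ∧ water MA MB (n + 1) = none

/-- The protocol computes `f`: on all inputs, the output, which is the parity of the length of the
path from the tap, is `f x y`. -/
def Protocol.Computes {X Y : Type*} {s : ℕ} (P : Protocol X Y s) (f : X → Y → Bool) : Prop :=
  ∀ x y, ∃ n, IsPathLength (P.alice x) (P.bob y) n ∧ (f x y = true ↔ Odd n)

/-- Garden-hose complexity: the least number of pipes of a protocol that computes `f`
(`⊤` if there is none). -/
noncomputable def GH {X Y : Type*} (f : X → Y → Bool) : ℕ∞ :=
  ⨅ (s : ℕ) (_ : ∃ P : Protocol X Y s, P.Computes f), (s : ℕ∞)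

/-- A gate function together with its fan-in. -/
abbrev Gate : Type := Σ m : ℕ, ((Fin m → Bool) → Bool)

/-- Boolean formulas with variables in `V`: trees whose leaves are variables or constants and whose
inner nodes are labelled by gate functions. -/
inductive Formula (V : Type) : Type
  | var (v : V) : Formula V
  | const (b : Bool) : Formula V
  | gate {m : ℕ} (φ : (Fin m → Bool) → Bool) (F : Fin m → Formula V) : Formula V

namespace Formula

variable {V : Type}

/-- The Boolean function computed by a formula. -/
def eval : Formula V → (V → Bool) → Bool
  | var v, z => z v
  | const b, _ => b
  | gate φ F, z => φ fun i => (F i).eval z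

/-- The size of a formula is its number of leaves. -/
def size : Formula V → ℕ
  | var _ => 1
  | const _ => 1
  | gate _ F => ∑ i, (F i).size

/-- All gates of the formula belong to `B`. -/
def IsOver (B : Set Gate) : Formula V → Prop
  | var _ => True
  | const _ => True
  | gate (m := m) φ F => (⟨m, φ⟩ : Gate) ∈ B ∧ ∀ i, (F i).IsOver B

/-- All leaves of the formula are variables. -/
def NoConst : Formula V → Prop
  | var _ => True
  | const _ => False
  | gate _ F => ∀ i, (F i).NoConst

/-- The formula is a formula for the Boolean function `g`. -/
def Computes (F : Formula V) (g : (V → Bool) → Bool) : Prop :=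
  ∀ z, F.eval z = g z

end Formula

def andFun (m : ℕ) (z : Fin m → Bool) : Bool := decide (∀ i, z i = true)

def orFun (m : ℕ) (z : Fin m → Bool) : Bool := decide (∃ i, z i = true)

def xorFun (m : ℕ) (z : Fin m → Bool) : Bool :=
  decide (Odd (Finset.univ.filter fun i => z i = true).card)

/-- AND, OR and XOR gates of arbitrary (positive) fan-in. -/
def andOrXor : Set Gate :=
  {G | ∃ m : ℕ, 0 < m ∧ (G = ⟨m, andFun m⟩ ∨ G = ⟨m, orFun m⟩ ∨ G = ⟨m, xorFun m⟩)}

/-- All 16 gates of fan-in 2. -/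
def fanInTwo : Set Gate := {G | G.1 = 2}

/-- The formula size of `g` relative to the gates in `B` (`⊤` if there is no formula for `g`). -/
noncomputable def formulaSize {V : Type} (B : Set Gate) (g : (V → Bool) → Bool) : ℕ∞ :=
  ⨅ (F : Formula V) (_ : F.IsOver B ∧ F.Computes g), (F.size : ℕ∞)

/-- The two-player function obtained from `g` by giving the variables in `A` to Alice and the
remaining ones to Bob. -/
def split {V : Type} [DecidableEq V] (A : Finset V) (g : (V → Bool) → Bool)
    (x : {v // v ∈ A} → Bool) (y : {v // v ∉ A} → Bool) : Bool :=
  g fun v => if h : v ∈ A then x ⟨v, h⟩ else y ⟨v, h⟩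

end GardenHose

/-! Garden-hose protocols perform reversible computations. Let the water carry a state from a finite
set `Q`, one pipe per state. Send it through a copy of a protocol for `f`, and from the place where
it is spilled back through a second copy: it emerges at the tap of that copy, in state `σ q` or `q`
according to the value of `f`. This takes `2 * |Q| * (c + 1)` vertices
(`Device.controlled_computes`). Hence a product of `n` permutations of `Q`, each controlled by one
bit `f i`, becomes a protocol of size linear in `n` (`Program.GH_le`).

It remains to evaluate a formula of size `s` with about `s ^ (1 + ε)` controlled steps (reads) in
the group of invertible linear maps on a bounded number of registers over the field with two
elements. A path from the root that always enters the larger subformula presents the formula as a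
composition of affine maps, whose coefficients depend on the smaller subformulas. A composition with
at most `2 * S` leaves is assembled from five with at most `S` leaves each. As long as garbage may
stay in the registers, assembling costs no reads but only registers (`PassBound.double`). Removing
the garbage by a commutator multiplies the reads by 4 (`Pass.computable`). If this is done only once
every `r` doublings, then `4 ^ l` reads per leaf suffice for `2 ^ (r * l)` leaves, a factor of order
`s ^ (2 / r)`, while the number of registers depends on `r` alone. Taking `r ≥ 2 / ε` proves the
upper bounds; the lower bounds follow by inverting the exponent. -/

namespace GardenHose

/-! ### Reversible flow of water along two matchings -/

section Flow

variable {V W : Type}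

/-- The matching whose edges are given by a symmetric, irreflexive, functional relation. -/
noncomputable def Matching.ofRel (r : V → V → Prop) (hs : ∀ u v, r u v → r v u)
    (hi : ∀ u, ¬ r u u) (hf : ∀ u v w, r u v → r u w → v = w) : Matching V :=
  have key : ∀ u v, (open Classical in if h : ∃ v, r u v then some h.choose else none) = some v ↔
      r u v := by
    intro u v
    by_cases h : ∃ v, r u v
    · rw [dif_pos h, Option.some_inj]
      exact ⟨fun e => e ▸ h.choose_spec, fun e => hf _ _ _ h.choose_spec e⟩
    · rw [dif_neg h]
      exact ⟨fun e => by simp at e, fun e => (h ⟨v, e⟩).elim⟩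
  { partner := fun u => open Classical in if h : ∃ v, r u v then some h.choose else none
    symm := fun u v h => (key v u).2 (hs _ _ ((key u v).1 h))
    irrefl := fun u h => hi u ((key u u).1 h) }

theorem Matching.ofRel_partner {r : V → V → Prop} {hs hi hf} {u v : V} :
    (Matching.ofRel r hs hi hf).partner u = some v ↔ r u v := by
  unfold Matching.ofRel
  by_cases h : ∃ v, r u v
  · simp only [dif_pos h, Option.some_inj]
    exact ⟨fun e => e ▸ h.choose_spec, fun e => hf _ _ _ h.choose_spec e⟩
  · simp only [dif_neg h]
    exact ⟨fun e => by simp at e, fun e => (h ⟨v, e⟩).elim⟩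

theorem Matching.ofRel_partner_none {r : V → V → Prop} {hs hi hf} {u : V} :
    (Matching.ofRel r hs hi hf).partner u = none ↔ ∀ v, ¬ r u v := by
  rw [Option.eq_none_iff_forall_ne_some]
  exact forall_congr' fun v => not_congr Matching.ofRel_partner

/-- Water that is at the end of a pipe on the side `a.2` (`false` for Alice, `true` for Bob)
flows through an edge of the matching on this side and through the next pipe. -/
def FlowStep (MA MB : Matching V) (a b : V × Bool) : Prop :=
  (bif a.2 then MB else MA).partner a.1 = some b.1 ∧ b.2 = !a.2

/-- The water flows from `a` to `b` in `n` steps. -/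
def FlowN (MA MB : Matching V) : ℕ → V × Bool → V × Bool → Prop
  | 0, a, b => a = b
  | n + 1, a, b => ∃ c, FlowStep MA MB a c ∧ FlowN MA MB n c b

/-- The water flows from `a` to `b`. -/
def Flow (MA MB : Matching V) (a b : V × Bool) : Prop := ∃ n, FlowN MA MB n a b

/-- The other end of the same pipe. -/
def flip (a : V × Bool) : V × Bool := (a.1, !a.2)

@[simp] theorem flip_flip (a : V × Bool) : flip (flip a) = a := by simp [flip]

variable {MA MB : Matching V}

theorem FlowStep.flip {a b : V × Bool} (h : FlowStep MA MB a b) :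
    FlowStep MA MB (flip b) (flip a) := by
  obtain ⟨h₁, h₂⟩ := h
  refine ⟨?_, by simp [GardenHose.flip, h₂]⟩
  have : (GardenHose.flip b).2 = a.2 := by simp [GardenHose.flip, h₂]
  rw [this]
  exact Matching.symm _ _ _ h₁

theorem FlowStep.unique {a b c : V × Bool} (h : FlowStep MA MB a b) (h' : FlowStep MA MB a c) :
    b = c :=
  Prod.ext (Option.some_injective _ (h.1.symm.trans h'.1)) (h.2.trans h'.2.symm)

theorem FlowStep.ne_flip {a : V × Bool} : ¬ FlowStep MA MB a (GardenHose.flip a) :=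
  fun h => Matching.irrefl _ _ h.1

theorem FlowN.trans {m n : ℕ} {a b c : V × Bool} (h : FlowN MA MB m a b)
    (h' : FlowN MA MB n b c) : FlowN MA MB (m + n) a c := by
  induction m generalizing a with
  | zero => cases h; simpa using h'
  | succ m ih =>
    obtain ⟨d, hd, hb⟩ := h
    rw [Nat.add_right_comm]
    exact ⟨d, hd, ih hb⟩

theorem FlowN.flip {n : ℕ} {a b : V × Bool} (h : FlowN MA MB n a b) :
    FlowN MA MB n (flip b) (flip a) := by
  induction n generalizing a with
  | zero => cases h; exact rfl
  | succ n ih =>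
    obtain ⟨d, hd, hb⟩ := h
    exact (ih hb).trans (n := 1) ⟨_, hd.flip, rfl⟩

/-- After a first step from `a` to `b`, the reversal of the remaining flow starts at `a` as well and
so begins with the same step. Removing it leaves a shorter flow from `b` to `flip b`. The descent
ends with an edge from a vertex to itself or with two ends of a pipe being equal. -/
theorem FlowN.ne_flip {n : ℕ} {a : V × Bool} : ¬ FlowN MA MB n a (GardenHose.flip a) := by
  induction n using Nat.strong_induction_on generalizing a with
  | _ n ih =>
    intro h
    match n, h with
    | 0, h => exact absurd (congrArg Prod.snd (show a = _ from h)) (by simp [GardenHose.flip])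
    | 1, ⟨b, hb, h⟩ => exact FlowStep.ne_flip (show FlowStep MA MB a _ from h ▸ hb)
    | n + 2, ⟨b, hb, h⟩ =>
      obtain ⟨c, hc, h'⟩ := h.flip
      rw [flip_flip] at hc
      cases hb.unique hc
      have := h'.flip
      rw [flip_flip] at this
      refine ih n (by omega) (a := b) ?_
      simpa using this

theorem Flow.refl (a : V × Bool) : Flow MA MB a a := ⟨0, rfl⟩

theorem Flow.trans {a b c : V × Bool} (h : Flow MA MB a b) (h' : Flow MA MB b c) :
    Flow MA MB a c :=
  let ⟨_, h⟩ := h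
  let ⟨_, h'⟩ := h'
  ⟨_, h.trans h'⟩

theorem Flow.single {a b : V × Bool} (h : FlowStep MA MB a b) : Flow MA MB a b := ⟨1, b, h, rfl⟩

theorem Flow.alice {u v : V} (h : MA.partner u = some v) : Flow MA MB (u, false) (v, true) :=
  Flow.single ⟨h, rfl⟩

theorem Flow.bob {u v : V} (h : MB.partner u = some v) : Flow MA MB (u, true) (v, false) :=
  Flow.single ⟨h, rfl⟩

theorem Flow.flip {a b : V × Bool} (h : Flow MA MB a b) : Flow MA MB (flip b) (flip a) :=
  let ⟨n, h⟩ := h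
  ⟨n, h.flip⟩

/-- Flows are preserved by edge-preserving maps. -/
theorem Flow.map {MA' MB' : Matching W} (φ : V → W)
    (hA : ∀ u v, MA.partner u = some v → MA'.partner (φ u) = some (φ v))
    (hB : ∀ u v, MB.partner u = some v → MB'.partner (φ u) = some (φ v))
    {a b : V × Bool} (h : Flow MA MB a b) : Flow MA' MB' (φ a.1, a.2) (φ b.1, b.2) := by
  obtain ⟨n, h⟩ := h
  induction n generalizing a with
  | zero => cases h; exact Flow.refl _
  | succ n ih =>
    obtain ⟨⟨c, i⟩, ⟨hd, hc⟩, hb⟩ := h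
    obtain ⟨u, j⟩ := a
    refine Flow.trans (Flow.single ⟨?_, hc⟩) (ih hb)
    cases j
    · exact hA _ _ hd
    · exact hB _ _ hd

/-- A matching on the pipes, seen as a matching on the pipes and the tap. -/
def Matching.extend (M : Matching V) : Matching (Option V) where
  partner u := (u.bind M.partner).map some
  symm u v h := by
    cases u with
    | none => simp at h
    | some u =>
      obtain ⟨w, hw, rfl⟩ := Option.map_eq_some_iff.1 h
      simpa using M.symm _ _ hw
  irrefl u h := by
    cases u with
    | none => simp at h
    | some u =>
      obtain ⟨w, hw, e⟩ := Option.map_eq_some_iff.1 h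
      cases e
      exact M.irrefl _ hw

theorem Matching.extend_some {M : Matching V} {u v : V} (h : M.partner u = some v) :
    M.extend.partner (some u) = some (some v) := by
  simp [Matching.extend, h]

theorem Matching.extend_eq_some {M : Matching V} {u v : Option V}
    (h : M.extend.partner u = some v) : ∃ a b, u = some a ∧ v = some b ∧ M.partner a = some b := by
  cases u with
  | none => simp [Matching.extend] at h
  | some u =>
    obtain ⟨w, hw, rfl⟩ := Option.map_eq_some_iff.1 h
    exact ⟨u, w, rfl, rfl, hw⟩

theorem Matching.extend_none {M : Matching V} {u : V} (h : M.partner u = none) :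
    M.extend.partner (some u) = none := by
  simp [Matching.extend, h]

/-- The water that starts at the tap is spilled on Bob's side if `b` holds and on Alice's side
otherwise. -/
def Spills (MA : Matching (Option V)) (MB : Matching V) (b : Bool) : Prop :=
  ∃ v, Flow MA MB.extend (none, false) (v, b) ∧ (bif b then MB.extend else MA).partner v = none

end Flow

/-! ### Path length parity and the side of the spill -/

section Water

variable {s : ℕ} {MA : Matching (Option (Fin s))} {MB : Matching (Fin s)}

theorem water_succ {n : ℕ} {u : Option (Fin s)} (h : water MA MB n = some u) :
    water MA MB (n + 1) = (bif decide (Odd n) then MB.extend else MA).partner u := by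
  by_cases hn : Even n
  · simp [water, h, hn, Nat.not_odd_iff_even.2 hn]
  · rw [Nat.not_even_iff_odd] at hn
    simp [water, h, hn, Matching.extend]

theorem flow_of_water {n : ℕ} {u : Option (Fin s)} (h : water MA MB n = some u) :
    Flow MA MB.extend (none, false) (u, decide (Odd n)) := by
  induction n generalizing u with
  | zero => cases h; exact Flow.refl _
  | succ n ih =>
    cases hw : water MA MB n with
    | none => simp [water, hw] at h
    | some w =>
      rw [water_succ hw] at h
      refine (ih hw).trans (Flow.single ⟨h, ?_⟩)
      simp [Nat.odd_add_one, -Nat.not_odd_iff_even]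

theorem water_of_flowN {m n : ℕ} {u : Option (Fin s)} {b : Option (Fin s) × Bool}
    (h : water MA MB m = some u) (hf : FlowN MA MB.extend n (u, decide (Odd m)) b) :
    ∃ k, water MA MB k = some b.1 ∧ b.2 = decide (Odd k) := by
  induction n generalizing m u with
  | zero => cases hf; exact ⟨m, h, rfl⟩
  | succ n ih =>
    obtain ⟨⟨c, i⟩, ⟨hc, hi⟩, hb⟩ := hf
    refine ih (m := m + 1) (u := c) ((water_succ h).trans hc) ?_
    have : i = decide (Odd (m + 1)) := by
      simpa [Nat.odd_add_one, -Nat.not_odd_iff_even] using hi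
    rwa [← this]

theorem spills_iff {b : Bool} :
    Spills MA MB b ↔ ∃ n, IsPathLength MA MB n ∧ (b = true ↔ Odd n) := by
  constructor
  · rintro ⟨v, ⟨n, hf⟩, hv⟩
    obtain ⟨k, hk, hb⟩ := water_of_flowN (m := 0) rfl hf
    simp only at hk hb
    refine ⟨k, ⟨by simp [hk], ?_⟩, by simp [hb]⟩
    rw [water_succ hk, ← hb, hv]
  · rintro ⟨n, ⟨h₁, h₂⟩, hb⟩
    obtain ⟨u, hu⟩ := Option.isSome_iff_exists.1 h₁
    have hb' : b = decide (Odd n) := by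
      rw [Bool.eq_iff_iff]; simpa using hb
    subst hb'
    exact ⟨u, flow_of_water hu, by rw [← water_succ hu, h₂]⟩

end Water

/-! ### Protocols on arbitrary finite sets of pipes -/

section Complexity

variable {X Y : Type*}

theorem GH_le_iff {f : X → Y → Bool} {c : ℕ} :
    GH f ≤ c ↔ ∃ s ≤ c, ∃ P : Protocol X Y s, P.Computes f := by
  constructor
  · intro h
    by_contra! hne
    have : ((c + 1 : ℕ) : ℕ∞) ≤ GH f := by
      refine le_iInf₂ fun s ⟨P, hP⟩ => ?_
      by_contra hs
      rw [Nat.cast_le, not_le] at hs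
      exact hne s (by omega) P hP
    have := this.trans h
    rw [Nat.cast_le] at this
    omega
  · rintro ⟨s, hs, P, hP⟩
    exact (iInf₂_le s ⟨P, hP⟩).trans (Nat.cast_le.2 hs)

/-- Matchings can be transported along a bijection. -/
def Matching.map {V W : Type} (e : V ≃ W) (M : Matching V) : Matching W where
  partner w := (M.partner (e.symm w)).map e
  symm u v h := by
    obtain ⟨w, hw, rfl⟩ := Option.map_eq_some_iff.1 h
    simp [M.symm _ _ hw]
  irrefl u h := by
    obtain ⟨w, hw, e'⟩ := Option.map_eq_some_iff.1 h
    rw [← e', e.symm_apply_apply] at hw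
    exact M.irrefl _ hw

theorem GH_le_card {V : Type} [Fintype V] {f : X → Y → Bool}
    (alice : X → Matching (Option V)) (bob : Y → Matching V)
    (h : ∀ x y, Spills (alice x) (bob y) (f x y)) : GH f ≤ Fintype.card V := by
  let e := Fintype.equivFin V
  let e' : Option V ≃ Option (Fin (Fintype.card V)) := e.optionCongr
  refine GH_le_iff.2 ⟨_, le_rfl,
    ⟨fun x => (alice x).map e', fun y => (bob y).map e⟩, fun x y => spills_iff.1 ?_⟩
  obtain ⟨v, hv, hn⟩ := h x y
  have hext : ∀ v, ((bob y).map e).extend.partner (e' v) = ((bob y).extend.partner v).map e' := by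
    intro v
    cases v with
    | none => rfl
    | some v => cases hb : (bob y).partner v <;> simp [Matching.extend, Matching.map, e', hb]
  have hA : ∀ v, ((alice x).map e').partner (e' v) = ((alice x).partner v).map e' := by
    intro v; simp [Matching.map]
  refine ⟨e' v, Flow.map e' ?_ ?_ hv, ?_⟩
  · intro u w h; simp [hA, h]
  · intro u w h; simp [hext, h]
  · cases hb : f x y
    · simp only [hb, cond_false] at hn ⊢
      simp [hA, hn]
    · simp only [hb, cond_true] at hn ⊢
      simp [hext, hn]

end Complexity

/-! ### Devices with states and their serial connection -/

section Device

/-- A garden-hose device with states in `Q`. The water may enter at the terminals `inp q` and leaves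
at the terminals `out q`. All the terminals are on Bob's side. -/
structure Device (X Y : Type*) (Q V : Type) where
  alice : X → Matching V
  bob : Y → Matching V
  inp : Q → V
  out : Q → V
  bob_inp : ∀ y q, (bob y).partner (inp q) = none
  bob_out : ∀ y q, (bob y).partner (out q) = none
  inp_injective : Function.Injective inp
  out_injective : Function.Injective out
  inp_ne_out : ∀ q q', inp q ≠ out q'

variable {X Y : Type*} {Q V W : Type}

/-- Water entering in state `q` leaves in state `π x y q`. -/
def Device.Computes (D : Device X Y Q V) (π : X → Y → Q → Q) : Prop :=
  ∀ x y q, Flow (D.alice x) (D.bob y) (D.inp q, false) (D.out (π x y q), true)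

/-- The device that does nothing. -/
noncomputable def Device.one (X Y : Type*) (Q : Type) : Device X Y Q (Bool × Q) where
  alice _ := Matching.ofRel (fun u v => u.1 = !v.1 ∧ u.2 = v.2)
    (fun u v h => by simp [h.1, h.2]) (fun u h => by simp at h)
    (fun u v w h h' => Prod.ext (by simpa using h.1.symm.trans h'.1) (h.2.symm.trans h'.2))
  bob _ := ⟨fun _ => none, by simp, by simp⟩
  inp q := (false, q)
  out q := (true, q)
  bob_inp _ _ := rfl
  bob_out _ _ := rfl
  inp_injective _ _ h := by simpa using h
  out_injective _ _ h := by simpa using h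
  inp_ne_out _ _ h := by simp at h

theorem Device.one_computes : (Device.one X Y Q).Computes fun _ _ q => q := fun _ _ _ =>
  Flow.alice (by simp only [Device.one, Matching.ofRel_partner]; simp)

/-- The disjoint union of two matchings. -/
def Matching.sum (M : Matching V) (N : Matching W) : Matching (V ⊕ W) where
  partner := Sum.elim (fun v => (M.partner v).map Sum.inl) (fun w => (N.partner w).map Sum.inr)
  symm u v h := by
    cases u <;> obtain ⟨w, hw, rfl⟩ := Option.map_eq_some_iff.1 h
    · simp [M.symm _ _ hw]
    · simp [N.symm _ _ hw]
  irrefl u h := by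
    cases u <;> obtain ⟨w, hw, e⟩ := Option.map_eq_some_iff.1 h <;> cases e
    · exact M.irrefl _ hw
    · exact N.irrefl _ hw

/-- The edges of Bob in a serial connection. -/
inductive SeriesRel (M : Matching V) (N : Matching W) (out : Q → V) (inp : Q → W) :
    V ⊕ W → V ⊕ W → Prop
  | left {u v} : M.partner u = some v → SeriesRel M N out inp (.inl u) (.inl v)
  | right {u v} : N.partner u = some v → SeriesRel M N out inp (.inr u) (.inr v)
  | link q : SeriesRel M N out inp (.inl (out q)) (.inr (inp q))
  | link' q : SeriesRel M N out inp (.inr (inp q)) (.inl (out q))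

/-- Bob's matching in a serial connection. -/
noncomputable def Matching.series (M : Matching V) (N : Matching W) (out : Q → V) (inp : Q → W)
    (hM : ∀ q, M.partner (out q) = none) (hN : ∀ q, N.partner (inp q) = none)
    (ho : Function.Injective out) (hi : Function.Injective inp) : Matching (V ⊕ W) :=
  Matching.ofRel (SeriesRel M N out inp)
    (by
      rintro _ _ (h | h | q | q)
      exacts [.left (M.symm _ _ h), .right (N.symm _ _ h), .link' q, .link q])
    (by
      rintro (u | u) h
      · cases h with | left h => exact M.irrefl _ h
      · cases h with | right h => exact N.irrefl _ h)
    (by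
      intro u v w h h'
      generalize hu : u = u' at h'
      cases h <;> cases h' <;> simp_all [ho.eq_iff, hi.eq_iff] <;> subst hu <;> simp_all)

/-- Two devices in series. -/
noncomputable def Device.comp (D : Device X Y Q V) (E : Device X Y Q W) : Device X Y Q (V ⊕ W) where
  alice x := (D.alice x).sum (E.alice x)
  bob y := (D.bob y).series (E.bob y) D.out E.inp (D.bob_out y) (E.bob_inp y) D.out_injective
    E.inp_injective
  inp q := .inl (D.inp q)
  out q := .inr (E.out q)
  bob_inp y q := Matching.ofRel_partner_none.2 fun v h => by
    generalize hu : Sum.inl (D.inp q) = u at h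
    cases h <;> simp_all [D.inp_ne_out]
    subst hu
    simp_all [D.bob_inp]
  bob_out y q := Matching.ofRel_partner_none.2 fun v h => by
    generalize hu : Sum.inr (E.out q) = u at h
    cases h <;> simp_all [(E.inp_ne_out _ _).symm]
    subst hu
    simp_all [E.bob_out]
  inp_injective _ _ h := D.inp_injective (by simpa using h)
  out_injective _ _ h := E.out_injective (by simpa using h)
  inp_ne_out _ _ h := by simp at h

theorem Device.comp_bob {D : Device X Y Q V} {E : Device X Y Q W} {y : Y} {u v : V ⊕ W} :
    ((D.comp E).bob y).partner u = some v ↔ SeriesRel (D.bob y) (E.bob y) D.out E.inp u v := by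
  simp only [Device.comp, Matching.series, Matching.ofRel_partner]

theorem Device.Computes.comp {D : Device X Y Q V} {E : Device X Y Q W} {π ρ : X → Y → Q → Q}
    (hD : D.Computes π) (hE : E.Computes ρ) :
    (D.comp E).Computes fun x y q => ρ x y (π x y q) := by
  intro x y q
  refine Flow.trans (Flow.map Sum.inl ?_ ?_ (hD x y q))
    (Flow.trans (Flow.bob (Device.comp_bob.2 (.link _)))
      (Flow.map Sum.inr ?_ ?_ (hE x y (π x y q))))
  · intro u v h; simp [Device.comp, Matching.sum, h]
  · intro u v h; exact Device.comp_bob.2 (.left h)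
  · intro u v h; simp [Device.comp, Matching.sum, h]
  · intro u v h; exact Device.comp_bob.2 (.right h)

/-- A device may permute its states. -/
def Device.reindex (D : Device X Y Q V) (σ : Equiv.Perm Q) : Device X Y Q V where
  alice := D.alice
  bob := D.bob
  inp := D.inp
  out q := D.out (σ.symm q)
  bob_inp := D.bob_inp
  bob_out y q := D.bob_out y _
  inp_injective := D.inp_injective
  out_injective := D.out_injective.comp σ.symm.injective
  inp_ne_out _ _ := D.inp_ne_out _ _

theorem Device.Computes.reindex {D : Device X Y Q V} {π : X → Y → Q → Q} (hD : D.Computes π)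
    (σ : Equiv.Perm Q) : (D.reindex σ).Computes fun x y q => σ (π x y q) := by
  intro x y q
  simpa [Device.reindex] using hD x y q

end Device

/-! ### Permutations controlled by a protocol -/

section Controlled

variable {X Y : Type*} {Q U : Type}

/-- Alice's edges in a controlled permutation: the ends of the forward copies are connected to
those of the backward copies. -/
inductive ControlledAlice (M : Matching (Option U)) :
    Bool × Q × Option U → Bool × Q × Option U → Prop
  | copy {u v} d q : M.partner u = some v → ControlledAlice M (d, q, u) (d, q, v)
  | link {u} d q : M.partner u = none → ControlledAlice M (d, q, u) (!d, q, u)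

/-- Bob's edges in a controlled permutation. -/
inductive ControlledBob (σ : Equiv.Perm Q) (M : Matching U) :
    Bool × Q × Option U → Bool × Q × Option U → Prop
  | copy {u v} (d : Bool) (q : Q) : M.partner u = some v →
      ControlledBob σ M (d, q, some u) (d, q, some v)
  | link {u} (q : Q) : M.partner u = none → ControlledBob σ M (false, q, some u) (true, σ q, some u)
  | link' {u} q : M.partner u = none → ControlledBob σ M (true, σ q, some u) (false, q, some u)

/-- The device that applies the permutation `σ` if a protocol outputs `true`. -/
noncomputable def Device.controlled (alice : X → Matching (Option U)) (bob : Y → Matching U)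
    (σ : Equiv.Perm Q) : Device X Y Q (Bool × Q × Option U) where
  alice x := Matching.ofRel (ControlledAlice (alice x))
    (by
      rintro _ _ (⟨d, q, h⟩ | ⟨d, q, h⟩)
      · exact .copy _ _ (Matching.symm _ _ _ h)
      · simpa using ControlledAlice.link (!d) q h)
    (by
      have key : ∀ {u v}, ControlledAlice (Q := Q) (alice x) u v → u ≠ v := by
        rintro _ _ (⟨d, q, h⟩ | ⟨d, q, h⟩) e
        · cases e; exact Matching.irrefl _ _ h
        · simp at e
      exact fun u h => key h rfl)
    (by
      intro u v w h h'
      generalize hu : u = u' at h'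
      cases h <;> cases h' <;> simp_all)
  bob y := Matching.ofRel (ControlledBob σ (bob y))
    (by
      rintro _ _ (⟨d, q, h⟩ | ⟨q, h⟩ | ⟨q, h⟩)
      · exact .copy _ _ (Matching.symm _ _ _ h)
      · exact .link' _ h
      · exact .link _ h)
    (by
      have key : ∀ {u v}, ControlledBob σ (bob y) u v → u ≠ v := by
        rintro _ _ (⟨d, q, h⟩ | ⟨q, h⟩ | ⟨q, h⟩) e
        · cases e; exact Matching.irrefl _ _ h
        · simp at e
        · simp at e
      exact fun u h => key h rfl)
    (by
      intro u v w h h'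
      generalize hu : u = u' at h'
      cases h <;> cases h' <;> simp_all)
  inp q := (false, q, none)
  out q := (true, q, none)
  bob_inp y q := Matching.ofRel_partner_none.2 fun v h => by cases h
  bob_out y q := Matching.ofRel_partner_none.2 fun v h => by
    generalize hu : (true, q, none) = u at h
    cases h <;> simp at hu
  inp_injective _ _ h := by simpa using h
  out_injective _ _ h := by simpa using h
  inp_ne_out _ _ h := by simp at h

theorem Device.controlled_alice {alice : X → Matching (Option U)} {bob : Y → Matching U}
    {σ : Equiv.Perm Q} {x : X} {u v : Bool × Q × Option U} :
    ((Device.controlled alice bob σ).alice x).partner u = some v ↔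
      ControlledAlice (alice x) u v := by
  simp only [Device.controlled, Matching.ofRel_partner]

theorem Device.controlled_bob {alice : X → Matching (Option U)} {bob : Y → Matching U}
    {σ : Equiv.Perm Q} {y : Y} {u v : Bool × Q × Option U} :
    ((Device.controlled alice bob σ).bob y).partner u = some v ↔
      ControlledBob σ (bob y) u v := by
  simp only [Device.controlled, Matching.ofRel_partner]

/-- The forward copy `q` brings the water to the point `v` of the spill. If this is on Alice's side,
her link leads to `v` in the backward copy `q`; if it is on Bob's side, his link leads to the
backward copy `σ q`. By reversibility the water then runs from `v` back to the tap of that copy,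
which is the output terminal. -/
theorem Device.controlled_computes {alice : X → Matching (Option U)} {bob : Y → Matching U}
    {f : X → Y → Bool} (hf : ∀ x y, Spills (alice x) (bob y) (f x y)) (σ : Equiv.Perm Q) :
    (Device.controlled alice bob σ).Computes fun x y q => if f x y then σ q else q := by
  intro x y q
  obtain ⟨v, hv, hn⟩ := hf x y
  have copy : ∀ d q {a b}, Flow (alice x) (bob y).extend a b →
      Flow ((Device.controlled alice bob σ).alice x) ((Device.controlled alice bob σ).bob y)
        ((d, q, a.1), a.2) ((d, q, b.1), b.2) := by
    intro d q a b h
    refine Flow.map (fun u => (d, q, u)) ?_ ?_ h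
    · intro u v h; exact Device.controlled_alice.2 (.copy _ _ h)
    · intro u v h
      obtain ⟨a, b, rfl, rfl, h'⟩ := Matching.extend_eq_some h
      exact Device.controlled_bob.2 (.copy _ _ h')
  have ho : ∀ q, (Device.controlled alice bob σ).out q = (true, q, none) := fun _ => rfl
  refine (copy false q hv).trans ?_
  cases hb : f x y
  · simp only [hb, cond_false] at hn hv
    refine (Flow.alice (Device.controlled_alice.2 (.link _ _ hn))).trans ?_
    simpa [flip, ho, hb] using copy true q hv.flip
  · simp only [hb, cond_true] at hn hv
    cases v with
    -- The tap cannot be the place of a spill on Bob's side: the water would have flowed from one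
    -- end of a pipe to its other end.
    | none => exact absurd hv fun ⟨n, h⟩ => FlowN.ne_flip h
    | some v =>
      have hn' : (bob y).partner v = none := by simpa [Matching.extend] using hn
      refine (Flow.bob (Device.controlled_bob.2 (.link _ hn'))).trans ?_
      simpa [flip, ho, hb] using copy true (σ q) hv.flip

end Controlled

/-! ### Group programs and their conversion to devices -/

section Program

/-- `Program p n`: the element `p z` of a group, which depends on the input bits `z`, is a product
of fixed elements and of at most `n` elements controlled by a single input bit. -/
inductive Program {K G : Type} [Group G] : ((K → Bool) → G) → ℕ → Prop
  | const (g : G) (n : ℕ) : Program (fun _ => g) n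
  | read (i : K) (g : G) : Program (fun z => if z i then g else 1) 1
  | mul {p q m n} : Program p m → Program q n → Program (fun z => p z * q z) (m + n)

variable {K G : Type} [Group G]

theorem Program.inv {p : (K → Bool) → G} {n : ℕ} (h : Program p n) :
    Program (fun z => (p z)⁻¹) n := by
  induction h with
  | const g n => exact .const _ _
  | read i g =>
    have : (fun z : K → Bool => (if z i then g else 1)⁻¹) = fun z => if z i then g⁻¹ else 1 := by
      funext z; split_ifs <;> simp
    exact this ▸ .read i g⁻¹
  | mul _ _ hp hq =>
    rw [add_comm]
    simpa using hq.mul hp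

theorem Program.const_mul {p : (K → Bool) → G} {n : ℕ} (g : G) (h : Program p n) :
    Program (fun z => g * p z) n := by
  simpa using (Program.const g 0).mul h

variable {X Y : Type*} {Q : Type} [Fintype Q] [MulAction G Q]

/-- Appending the program to an arbitrary device `D` makes the induction work for products. A
constant element merely relabels the outputs. A read costs one controlled permutation: two
directions, one copy for each state, and the pipes and the tap in each copy. -/
theorem Program.exists_device {p : (K → Bool) → G} {n : ℕ} (h : Program p n)
    {f : K → X → Y → Bool} {c : ℕ} (hf : ∀ i, GH (f i) ≤ c) {V : Type} [Fintype V]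
    {π : X → Y → Q → Q} {D : Device X Y Q V} (hD : D.Computes π) :
    ∃ (W : Type) (_ : Fintype W) (E : Device X Y Q W),
      (E.Computes fun x y q => p (fun i => f i x y) • π x y q) ∧
      Fintype.card W ≤ Fintype.card V + n * (2 * Fintype.card Q * (c + 1)) := by
  induction h generalizing V π with
  | const g n =>
    exact ⟨V, inferInstance, D.reindex (MulAction.toPerm g), hD.reindex _, Nat.le_add_right _ _⟩
  | read i g =>
    obtain ⟨s, hs, P, hP⟩ := GH_le_iff.1 (hf i)
    have hP' : ∀ x y, Spills (P.alice x) (P.bob y) (f i x y) := fun x y => spills_iff.2 (hP x y)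
    refine ⟨V ⊕ (Bool × Q × Option (Fin s)), inferInstance,
      D.comp (Device.controlled P.alice P.bob (MulAction.toPerm g)), ?_, ?_⟩
    · convert hD.comp (Device.controlled_computes hP' (MulAction.toPerm g)) using 4 with x y q
      by_cases h : f i x y <;> simp [h]
    · simp only [Fintype.card_sum, Fintype.card_prod, Fintype.card_bool, Fintype.card_option,
        Fintype.card_fin, one_mul, mul_assoc]
      gcongr
  | mul _ _ hp hq =>
    -- For a left action the right factor acts first.
    obtain ⟨W, _, E, hE, hW⟩ := hq hD
    obtain ⟨W', _, E', hE', hW'⟩ := hp hE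
    refine ⟨W', inferInstance, E', ?_, ?_⟩
    · simpa [mul_smul] using hE'
    · rw [add_mul]; omega

end Program

/-! ### From devices to protocols -/

section Output

variable {X Y : Type*} {Q V : Type}

/-- Alice's edges when the tap is connected to a device. -/
inductive TapAlice (M : Matching V) : Option (V ⊕ Bool) → Option (V ⊕ Bool) → Prop
  | copy {u v} : M.partner u = some v → TapAlice M (some (.inl u)) (some (.inl v))
  | tap : TapAlice M none (some (.inr false))
  | tap' : TapAlice M (some (.inr false)) none

/-- Bob's edges when the tap is connected to the terminal `a` of a device, and the terminal `b`
to a pipe that is open on Alice's side. -/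
inductive TapBob (M : Matching V) (a b : V) : V ⊕ Bool → V ⊕ Bool → Prop
  | copy {u v} : M.partner u = some v → TapBob M a b (.inl u) (.inl v)
  | inp : TapBob M a b (.inr false) (.inl a)
  | inp' : TapBob M a b (.inl a) (.inr false)
  | out : TapBob M a b (.inr true) (.inl b)
  | out' : TapBob M a b (.inl b) (.inr true)

/-- One extra pipe leads from the tap to the input `q₀`, and another from the output `q₁` to an open
end on Alice's side. All the other outputs are open on Bob's side, so the water is spilled with
Alice exactly if it leaves in state `q₁`. -/
theorem Device.Computes.GH_le [Fintype V] {D : Device X Y Q V} {π : X → Y → Q → Q}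
    (hD : D.Computes π) {f : X → Y → Bool} (q₀ q₁ : Q)
    (hf : ∀ x y, f x y = false ↔ π x y q₀ = q₁) : GH f ≤ (Fintype.card V + 2 : ℕ) := by
  have hne : ∀ q q', D.out q ≠ D.inp q' := fun q q' => (D.inp_ne_out q' q).symm
  let alice : X → Matching (Option (V ⊕ Bool)) := fun x =>
    Matching.ofRel (TapAlice (D.alice x))
      (by
        rintro _ _ (h | _ | _)
        exacts [.copy (Matching.symm _ _ _ h), .tap', .tap])
      (by
        rintro (_ | _ | _) h
        · cases h
        · cases h with | copy h => exact Matching.irrefl _ _ h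
        · cases h)
      (by
        intro u v w h h'
        cases h <;> cases h' <;> simp_all)
  let bob : Y → Matching (V ⊕ Bool) := fun y =>
    Matching.ofRel (TapBob (D.bob y) (D.inp q₀) (D.out q₁))
      (by
        rintro _ _ (h | _ | _ | _ | _)
        exacts [.copy (Matching.symm _ _ _ h), .inp', .inp, .out', .out])
      (by
        rintro (_ | _) h
        · cases h with | copy h => exact Matching.irrefl _ _ h
        · cases h)
      (by
        intro u v w h h'
        generalize hu : u = u' at h'
        have h₁ := D.bob_inp y q₀
        have h₂ := D.bob_out y q₁
        cases h <;> cases h' <;> simp_all [D.inp_ne_out])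
  have hA : ∀ {x u v}, (alice x).partner u = some v ↔ TapAlice (D.alice x) u v :=
    Matching.ofRel_partner
  have hB : ∀ {y u v}, (bob y).partner u = some v ↔
      TapBob (D.bob y) (D.inp q₀) (D.out q₁) u v := Matching.ofRel_partner
  have := GH_le_card (f := f) alice bob fun x y => ?_
  · simpa using this
  have flow : Flow (alice x) (bob y).extend (none, false) (some (.inl (D.out (π x y q₀))), true) := by
    refine (Flow.alice (hA.2 .tap)).trans ((Flow.bob (Matching.extend_some (hB.2 .inp))).trans ?_)
    refine Flow.map (fun v => some (Sum.inl v)) ?_ ?_ (hD x y q₀)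
    · exact fun u v h => hA.2 (.copy h)
    · exact fun u v h => Matching.extend_some (hB.2 (.copy h))
  cases hb : f x y
  · rw [(hf x y).1 hb] at flow
    refine ⟨_, flow.trans (Flow.bob (Matching.extend_some (hB.2 .out'))), ?_⟩
    refine Option.eq_none_iff_forall_ne_some.2 fun v h => ?_
    cases hA.1 h
  · refine ⟨_, flow, Matching.extend_none (Matching.ofRel_partner_none.2 fun v h => ?_)⟩
    have hq : π x y q₀ ≠ q₁ := fun h => by simp [(hf x y).2 h] at hb
    generalize hu : Sum.inl (D.out (π x y q₀)) = u at h
    cases h with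
    | copy h => cases hu; simp [D.bob_out] at h
    | inp => cases hu
    | inp' => exact hne _ _ (Sum.inl_injective hu)
    | out => cases hu
    | out' => exact hq (D.out_injective (Sum.inl_injective hu))

theorem Program.GH_le {K G : Type} [Group G] [Fintype Q] [MulAction G Q] {p : (K → Bool) → G}
    {n : ℕ} (h : Program p n) {f : K → X → Y → Bool} {c : ℕ} (hf : ∀ i, GH (f i) ≤ c)
    (g : (K → Bool) → Bool) (q₀ q₁ : Q) (hg : ∀ z, g z = false ↔ p z • q₀ = q₁) :
    GH (fun x y => g fun i => f i x y) ≤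
      (n * (2 * Fintype.card Q * (c + 1)) + 2 * Fintype.card Q + 2 : ℕ) := by
  -- Starting from the trivial device accounts for the term `2 * |Q|`.
  obtain ⟨W, _, E, hE, hW⟩ := h.exists_device hf (Device.one_computes (X := X) (Y := Y) (Q := Q))
  refine (hE.GH_le q₀ q₁ fun x y => hg _).trans (Nat.cast_le.2 ?_)
  simp at hW
  omega

end Output

/-! ### Linear register programs over the field with two elements -/

section Registers

open Module

variable {K ι : Type} [DecidableEq ι]

/-- The invertible linear maps on the contents of registers over the field with two elements. -/
abbrev RegAut (ι : Type) : Type := (ι → ZMod 2) ≃ₗ[ZMod 2] (ι → ZMod 2)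

/-- The functions `α` and `β` can be computed with `n` reads, in the following sense: for all
registers `s`, `t`, `u` some program adds `β` and `α` times the contents of `s` to `t` and `u`. -/
def Computable (ι : Type) [DecidableEq ι] (α β : (K → Bool) → ZMod 2) (n : ℕ) : Prop :=
  ∀ s t u : ι, s ≠ t → s ≠ u → t ≠ u → ∃ p : (K → Bool) → RegAut ι, Program p n ∧
    ∀ z R, p z R = R + R s • (Pi.single t (β z) + Pi.single u (α z))

/-- Some program with `n` reads takes the unit vector of the register `s` to `w`, while it only
uses the registers in `J ∪ {s}` and only changes those in `J`. -/
def Reach (J : Finset ι) (s : ι) (n : ℕ) (w : (K → Bool) → ι → ZMod 2) : Prop :=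
  ∃ p : (K → Bool) → RegAut ι, Program p n ∧ (∀ z, p z (Pi.single s 1) = w z) ∧
    (∀ z R, (∀ j ∈ J, R j = 0) → R s = 0 → p z R = R) ∧ ∀ z R, ∀ j ∉ J, p z R j = R j

theorem Reach.mono {J J' : Finset ι} {s : ι} {n : ℕ} {w : (K → Bool) → ι → ZMod 2}
    (h : Reach J s n w) (hJ : J ⊆ J') : Reach J' s n w := by
  obtain ⟨p, hp, h₁, h₂, h₃⟩ := h
  exact ⟨p, hp, h₁, fun z R hR => h₂ z R fun j hj => hR j (hJ hj),
    fun z R j hj => h₃ z R j fun hj' => hj (hJ hj')⟩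

theorem Reach.apply_of_notMem {J : Finset ι} {s : ι} {n : ℕ} {w : (K → Bool) → ι → ZMod 2}
    (h : Reach J s n w) (z : K → Bool) {j : ι} (hj : j ∉ J) (hs : j ≠ s) : w z j = 0 := by
  obtain ⟨p, hp, h₁, h₂, h₃⟩ := h
  rw [← h₁, h₃ z _ j hj, Pi.single_eq_of_ne hs]

/-- Adding a linear form in the other registers to `t` is a fixed transvection, so it needs no read.
-/
theorem Reach.addTo {J : Finset ι} {s : ι} {n : ℕ} {w : (K → Bool) → ι → ZMod 2}
    (h : Reach J s n w) {t : ι} (ht : t ∈ J) (φ : Dual (ZMod 2) (ι → ZMod 2))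
    (hφ : φ (Pi.single t 1) = 0) (hφ' : ∀ R, (∀ j ∈ J, R j = 0) → R s = 0 → φ R = 0) :
    Reach J s n fun z => w z + Pi.single t (φ (w z)) := by
  obtain ⟨p, hp, h₁, h₂, h₃⟩ := h
  refine ⟨_, hp.const_mul (LinearEquiv.transvection hφ), fun z => ?_, fun z R hR hs => ?_,
    fun z R j hj => ?_⟩
  · rw [LinearEquiv.mul_apply, h₁, LinearEquiv.transvection.apply, ← Pi.single_smul]
    simp
  · rw [LinearEquiv.mul_apply, h₂ z R hR hs, LinearEquiv.transvection.apply, hφ' R hR hs]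
    simp
  · have : j ≠ t := by rintro rfl; exact hj ht
    rw [LinearEquiv.mul_apply, LinearEquiv.transvection.apply]
    simp [this, h₃ z R j hj]

/-- By linearity the second program turns the content `w z u` of `u` into `w z u • w' z`. The rest
of `w z` vanishes on `J'` and at `u`, so the second program leaves it alone. -/
theorem Reach.chain {J J' : Finset ι} {s u : ι} {m n : ℕ} {w w' : (K → Bool) → ι → ZMod 2}
    (h : Reach J s m w) (h' : Reach J' u n w') (hJ : Disjoint J J') (hs : s ∉ J') (hu : u ∈ J) :
    Reach (J ∪ J') s (m + n) fun z => w z + w z u • (w' z - Pi.single u 1) := by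
  have hw : ∀ z, ∀ j ∈ J', w z j = 0 := fun z j hj =>
    h.apply_of_notMem z (Finset.disjoint_right.1 hJ hj) (by rintro rfl; exact hs hj)
  obtain ⟨p, hp, h₁, h₂, h₃⟩ := h
  obtain ⟨q, hq, h₁', h₂', h₃'⟩ := h'
  refine ⟨fun z => q z * p z, add_comm m n ▸ hq.mul hp, fun z => ?_, fun z R hR hs' => ?_,
    fun z R j hj => ?_⟩
  · have e : w z = (w z - w z u • Pi.single u 1) + w z u • Pi.single u 1 := by abel
    rw [LinearEquiv.mul_apply, h₁]
    conv_lhs => rw [e]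
    rw [map_add, map_smul, h₁', h₂']
    · simp only [smul_sub]; abel
    · intro j hj
      have : j ≠ u := by rintro rfl; exact Finset.disjoint_left.1 hJ hu hj
      simp [hw z j hj, this]
    · simp
  · rw [LinearEquiv.mul_apply, h₂ z R (fun j hj => hR j (Finset.mem_union_left _ hj)) hs',
      h₂' z R (fun j hj => hR j (Finset.mem_union_right _ hj)) (hR u (Finset.mem_union_left _ hu))]
  · rw [Finset.mem_union, not_or] at hj
    rw [LinearEquiv.mul_apply, h₃' _ _ _ hj.2, h₃ _ _ _ hj.1]

/-- The functions `α` and `β` can be produced from a unit vector by a program with `n` reads on any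
`k` registers, the other registers of which may contain anything in the end. -/
def Pass (ι : Type) [DecidableEq ι] (k : ℕ) (α β : (K → Bool) → ZMod 2) (n : ℕ) : Prop :=
  ∀ (s : ι) (J : Finset ι), s ∉ J → k ≤ J.card → ∃ t ∈ J, ∃ u ∈ J, t ≠ u ∧
    ∃ w : (K → Bool) → ι → ZMod 2, Reach J s n w ∧ ∀ z, w z t = β z ∧ w z u = α z

theorem Computable.pass {α β : (K → Bool) → ZMod 2} {n : ℕ} (h : Computable ι α β n) :
    Pass ι 2 α β n := by
  intro s J hs hJ
  obtain ⟨t, ht, u, hu, htu⟩ := Finset.one_lt_card.1 (show 1 < J.card from hJ)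
  have hst : s ≠ t := by rintro rfl; exact hs ht
  have hsu : s ≠ u := by rintro rfl; exact hs hu
  obtain ⟨p, hp, h⟩ := h s t u hst hsu htu
  refine ⟨t, ht, u, hu, htu, _, ⟨p, hp, fun _ => rfl, fun z R hR hs => by simp [h, hs],
    fun z R j hj => ?_⟩, fun z => ?_⟩
  · have h₁ : j ≠ t := by rintro rfl; exact hj ht
    have h₂ : j ≠ u := by rintro rfl; exact hj hu
    simp [h, h₁, h₂]
  · simp [h, htu, htu.symm, hst.symm, hsu.symm]

theorem Pass.mono {k k' : ℕ} {α β : (K → Bool) → ZMod 2} {n : ℕ} (h : Pass ι k α β n)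
    (hk : k ≤ k') : Pass ι k' α β n :=
  fun s J hs hJ => h s J hs (hk.trans hJ)

/-- The composition of two affine maps. -/
theorem Pass.comp {k k' : ℕ} {α β α' β' : (K → Bool) → ZMod 2} {m n : ℕ}
    (h : Pass ι k α β m) (h' : Pass ι k' α' β' n) :
    Pass ι (k + k' + 1) (fun z => α z * α' z) (fun z => β z + α z * β' z) (m + n) := by
  intro s J hs hJ
  obtain ⟨J₁, hJ₁, hk₁⟩ := Finset.exists_subset_card_eq (show k ≤ J.card by omega)
  have hc : (J \ J₁).card = J.card - k := by rw [Finset.card_sdiff_of_subset hJ₁, hk₁]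
  obtain ⟨J₂, hJ₂, hk₂⟩ := Finset.exists_subset_card_eq (show k' ≤ (J \ J₁).card by omega)
  obtain ⟨r, hr, hr₂⟩ := Finset.exists_mem_notMem_of_card_lt_card (show J₂.card < (J \ J₁).card by
    omega)
  rw [Finset.mem_sdiff] at hr
  obtain ⟨t₁, ht₁, u₁, hu₁, htu₁, w₁, hw₁, e₁⟩ := h s J₁ (fun h => hs (hJ₁ h)) hk₁.ge
  have hdis : Disjoint J₁ J₂ := (Finset.disjoint_sdiff.mono_right hJ₂)
  have hJ₂' : J₂ ⊆ J := hJ₂.trans Finset.sdiff_subset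
  obtain ⟨t₂, ht₂, u₂, hu₂, htu₂, w₂, hw₂, e₂⟩ := h' u₁ J₂ (Finset.disjoint_left.1 hdis hu₁) hk₂.ge
  have hr₁ := hr.2
  have hu := (hw₁.chain hw₂ hdis (fun h => hs (hJ₂' h)) hu₁).mono (Finset.union_subset hJ₁ hJ₂')
  have hne : ∀ {a b}, a ∈ J₁ → b ∈ J₂ → b ≠ a := by
    rintro a _ ha hb rfl; exact Finset.disjoint_left.1 hdis ha hb
  have hne₁ : ∀ {a}, a ∈ J₁ → a ≠ r := by rintro a ha rfl; exact hr₁ ha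
  have hne₂ : ∀ {a}, a ∈ J₂ → a ≠ r := by rintro a ha rfl; exact hr₂ ha
  have hrs : r ≠ s := by rintro rfl; exact hs hr.1
  have z₁ : ∀ z, ∀ j ∈ J₂, w₁ z j = 0 := fun z j hj =>
    hw₁.apply_of_notMem z (Finset.disjoint_right.1 hdis hj) (by rintro rfl; exact hs (hJ₂' hj))
  have hrz₁ : ∀ z, w₁ z r = 0 := fun z => hw₁.apply_of_notMem z hr₁ hrs
  have hrz₂ : ∀ z, w₂ z r = 0 := fun z => hw₂.apply_of_notMem z hr₂ (hne₁ hu₁).symm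
  have htz₂ : ∀ z, w₂ z t₁ = 0 := fun z =>
    hw₂.apply_of_notMem z (Finset.disjoint_left.1 hdis ht₁) htu₁
  -- Fed with `α` from `u₁`, the second program leaves `α * α'` in `u₂` and `α * β'` in `t₂`. The
  -- spare register `r`, which is the `+ 1` in the register count, collects the sum of `t₁` and
  -- `t₂`.
  refine ⟨r, hr.1, u₂, hJ₂' hu₂, (hne₂ hu₂).symm, _, hu.addTo hr.1
    (LinearMap.proj (R := ZMod 2) (φ := fun _ : ι => ZMod 2) t₁ + LinearMap.proj t₂) ?_ ?_, fun z => ⟨?_, ?_⟩⟩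
  · simp [hne₁ ht₁, hne₂ ht₂]
  · intro R hR _
    simp [hR t₁ (hJ₁ ht₁), hR t₂ (hJ₂' ht₂)]
  · simp [hrz₁, hrz₂, (hne₁ hu₁).symm, htz₂, htu₁, e₁, e₂, z₁ z t₂ ht₂, hne hu₁ ht₂]
  · simp [hne₂ hu₂, e₁, e₂, z₁ z u₂ hu₂, hne hu₁ hu₂]

/-- Affine changes of the two functions are free. -/
theorem Pass.affine {k : ℕ} {α β : (K → Bool) → ZMod 2} {n : ℕ} (h : Pass ι k α β n)
    (a b : Fin 3 → ZMod 2) :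
    Pass ι (k + 2) (fun z => a 0 + a 1 * α z + a 2 * β z) (fun z => b 0 + b 1 * α z + b 2 * β z)
      n := by
  intro s J hs hJ
  obtain ⟨J₁, hJ₁, hk₁⟩ := Finset.exists_subset_card_eq (show k ≤ J.card by omega)
  have hc : (J \ J₁).card = J.card - k := by rw [Finset.card_sdiff_of_subset hJ₁, hk₁]
  obtain ⟨t', ht', u', hu', htu'⟩ := Finset.one_lt_card.1 (show 1 < (J \ J₁).card by omega)
  rw [Finset.mem_sdiff] at ht' hu'
  obtain ⟨t, ht, u, hu, htu, w, hw, e⟩ := h s J₁ (fun h => hs (hJ₁ h)) hk₁.ge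
  have hsJ : ∀ {j}, j ∈ J → j ≠ s := by rintro j hj rfl; exact hs hj
  have hne : ∀ {i j}, i ∈ J₁ → j ∉ J₁ → i ≠ j := by rintro i _ hi hj rfl; exact hj hi
  have zt : ∀ z, w z t' = 0 := fun z => hw.apply_of_notMem z ht'.2 (hsJ ht'.1)
  have zu : ∀ z, w z u' = 0 := fun z => hw.apply_of_notMem z hu'.2 (hsJ hu'.1)
  -- The register `s` still contains the initial 1, which supplies the constant terms.
  have es : ∀ z, w z s = 1 := by
    intro z
    obtain ⟨p, -, h₁, -, h₃⟩ := hw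
    rw [← h₁, h₃ z _ s fun h => hs (hJ₁ h), Pi.single_eq_same]
  let φ : (Fin 3 → ZMod 2) → Dual (ZMod 2) (ι → ZMod 2) := fun a =>
    a 0 • LinearMap.proj s + a 1 • LinearMap.proj u + a 2 • LinearMap.proj t
  have hφ : ∀ a R, φ a R = a 0 * R s + a 1 * R u + a 2 * R t := fun a R => by simp [φ]
  have key : ∀ a R, (∀ j ∈ J, R j = 0) → R s = 0 → φ a R = 0 := fun a R hR hs => by
    simp [hφ, hs, hR t (hJ₁ ht), hR u (hJ₁ hu)]
  refine ⟨t', ht'.1, u', hu'.1, htu', _,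
    ((hw.mono hJ₁).addTo ht'.1 (φ b) ?_ (key b)).addTo hu'.1 (φ a) ?_ (key a), fun z => ⟨?_, ?_⟩⟩
  · simp [hφ, hne ht ht'.2, hne hu ht'.2, (hsJ ht'.1).symm]
  · simp [hφ, hne ht hu'.2, hne hu hu'.2, (hsJ hu'.1).symm]
  · simp [hφ, zt, es, e, htu']
  · simp [hφ, zu, es, e, htu'.symm, hne ht ht'.2, hne hu ht'.2, (hsJ ht'.1).symm]

/-- The program `p` runs on an auxiliary register `s'` and on `J`. Conjugating by it the map `M`,
which adds its results to `t` and `u`, undoes all its garbage and costs `2 * n` reads. The conjugate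
`P` still depends on the initial contents of `s'` and `J`. The commutator of `P` with the addition
`C` of `s` to `s'` cancels these contributions and keeps the multiple of `R s`. The four further
registers are `s'`, `s`, `t`, `u`. -/
theorem Pass.computable [Fintype ι] {k : ℕ} {α β : (K → Bool) → ZMod 2} {n : ℕ}
    (h : Pass ι k α β n) (hk : k + 4 ≤ Fintype.card ι) : Computable ι α β (4 * n) := by
  intro s t u hst hsu htu
  have hcard : ({s, t, u} : Finset ι).card ≤ 3 := Finset.card_le_three
  obtain ⟨s', -, hs'⟩ := Finset.exists_mem_notMem_of_card_lt_card
    (show ({s, t, u} : Finset ι).card < Finset.univ.card by rw [Finset.card_univ]; omega)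
  simp only [Finset.mem_insert, Finset.mem_singleton, not_or] at hs'
  obtain ⟨hs's, hs't, hs'u⟩ := hs'
  let J : Finset ι := Finset.univ \ {s', s, t, u}
  have hJ : k ≤ J.card := by
    have : ({s', s, t, u} : Finset ι).card ≤ 4 := Finset.card_le_four
    have := Finset.le_card_sdiff ({s', s, t, u} : Finset ι) Finset.univ
    rw [Finset.card_univ] at this
    change k ≤ (Finset.univ \ {s', s, t, u} : Finset ι).card
    omega
  have hJ' : ∀ {j}, j ∈ J ↔ j ≠ s' ∧ j ≠ s ∧ j ≠ t ∧ j ≠ u := by simp [J]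
  obtain ⟨t', ht', u', hu', htu', w, ⟨p, hp, h₁, h₂, h₃⟩, hw⟩ := h s' J (by simp [J]) hJ
  rw [hJ'] at ht' hu'
  -- The targets `t` and `u` are neither used nor changed by `p`, so additions to them survive the
  -- conjugation.
  have ht : ∀ z (c : ZMod 2), p z (Pi.single t c) = Pi.single t c := fun z c =>
    h₂ z _ (fun j hj => Pi.single_eq_of_ne (hJ'.1 hj).2.2.1 _) (Pi.single_eq_of_ne hs't _)
  have hu : ∀ z (c : ZMod 2), p z (Pi.single u c) = Pi.single u c := fun z c =>
    h₂ z _ (fun j hj => Pi.single_eq_of_ne (hJ'.1 hj).2.2.2 _) (Pi.single_eq_of_ne hs'u _)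
  have hφt : (LinearMap.proj t' : Dual (ZMod 2) (ι → ZMod 2)) (Pi.single t 1) = 0 := by
    simp [ht'.2.2.1]
  have hφu : (LinearMap.proj u' : Dual (ZMod 2) (ι → ZMod 2)) (Pi.single u 1) = 0 := by
    simp [hu'.2.2.2]
  have hφs : (LinearMap.proj s : Dual (ZMod 2) (ι → ZMod 2)) (Pi.single s' 1) = 0 := by
    simp [Ne.symm hs's]
  let M : RegAut ι := LinearEquiv.transvection hφt * LinearEquiv.transvection hφu
  let C : RegAut ι := LinearEquiv.transvection hφs
  have hC : ∀ R, C R = R + Pi.single s' (R s) := fun R => by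
    rw [LinearEquiv.transvection.apply, ← Pi.single_smul]; simp
  have hM : ∀ R, M R = R + Pi.single t (R t') + Pi.single u (R u') := fun R => by
    simp only [M, LinearEquiv.mul_apply, LinearEquiv.transvection.apply, ← Pi.single_smul]
    simp [ht'.2.2.2, add_right_comm]
  let P : (K → Bool) → RegAut ι := fun z => (p z)⁻¹ * (M * p z)
  have hP : ∀ z R, P z R = R + Pi.single t (p z R t') + Pi.single u (p z R u') := by
    intro z R
    have : p z (P z R) = M (p z R) := by
      simp only [P, LinearEquiv.mul_apply]
      exact (p z).apply_symm_apply _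
    apply (p z).injective
    rw [this, hM, map_add, map_add, ht, hu]
  have hPp : Program P (n + n) := hp.inv.mul (hp.const_mul M)
  refine ⟨fun z => (P z)⁻¹ * (C⁻¹ * (P z * C)), ?_, fun z R => ?_⟩
  · have : 4 * n = (n + n) + (n + n + 0) := by ring
    rw [this]
    exact hPp.inv.mul ((hPp.mul (.const C 0)).const_mul C⁻¹)
  · simp only [LinearEquiv.mul_apply]
    refine (P z).symm_apply_eq.2 (C.symm_apply_eq.2 ?_)
    rw [hP, hP, hC, hC]
    have e : (Pi.single s' (R s) : ι → ZMod 2) = R s • Pi.single s' 1 := by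
      rw [← Pi.single_smul]; simp
    simp only [map_add, map_smul, ht, hu, e, h₁]
    simp [hw, ht'.2.2.1, ht'.2.2.2, hu'.2.2.1, hu'.2.2.2, hst, hsu]
    rw [e]
    simp only [Pi.single_add, ← smul_eq_mul, Pi.single_smul]
    abel

theorem Computable.const (a b : ZMod 2) (n : ℕ) :
    Computable (K := K) ι (fun _ => a) (fun _ => b) n := by
  intro s t u hst hsu htu
  have h : (LinearMap.proj s : Dual (ZMod 2) (ι → ZMod 2)) (Pi.single t b + Pi.single u a) = 0 := by
    simp [hst, hsu]
  exact ⟨_, .const (LinearEquiv.transvection h) n, fun z R => by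
    rw [LinearEquiv.transvection.apply, LinearMap.proj_apply]⟩

theorem Computable.read (i : K) (a b c d : ZMod 2) :
    Computable (K := K) ι (fun z => a + if z i then b else 0) (fun z => c + if z i then d else 0)
      1 := by
  intro s t u hst hsu htu
  have h : ∀ a b, (LinearMap.proj s : Dual (ZMod 2) (ι → ZMod 2))
    (Pi.single t b + Pi.single u a) = 0 := by simp [hst, hsu]
  refine ⟨_, (Program.read i (LinearEquiv.transvection (h b d))).const_mul
    (LinearEquiv.transvection (h a c)), fun z R => ?_⟩
  rw [LinearEquiv.mul_apply, LinearEquiv.transvection.apply]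
  by_cases hz : z i
  · simp only [hz, if_true, LinearEquiv.transvection.apply]
    simp [hst, hsu, Pi.single_add]
    abel
  · simp [hz]

end Registers

/-! ### Binary formulas as compositions of affine maps -/

section BinaryFormula

variable {K : Type}

/-- The field element that represents a bit. -/
def bit (b : Bool) : ZMod 2 := if b then 1 else 0

/-- Formulas with gates of fan-in two, given by polynomials `a + b * x + c * y + d * x * y` over
the field with two elements. -/
inductive BinaryFormula (K : Type) : Type
  | var (i : K) : BinaryFormula K
  | const (a : ZMod 2) : BinaryFormula K
  | gate (a b c d : ZMod 2) (F G : BinaryFormula K) : BinaryFormula K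

namespace BinaryFormula

/-- The function computed by a binary formula. -/
def eval : BinaryFormula K → (K → Bool) → ZMod 2
  | var i, z => bit (z i)
  | const a, _ => a
  | gate a b c d F G, z => a + b * F.eval z + c * G.eval z + d * F.eval z * G.eval z

/-- The number of leaves. -/
def size : BinaryFormula K → ℕ
  | var _ => 1
  | const _ => 1
  | gate _ _ _ _ F G => F.size + G.size

theorem one_le_size (F : BinaryFormula K) : 1 ≤ F.size := by
  induction F with
  | var | const => exact le_rfl
  | gate a b c d F G hF hG => exact hF.trans (Nat.le_add_right _ _)

end BinaryFormula

/-- A gate one input of which is fed by a formula, as an affine function of its other input `x`: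
`(a + b * g) + (c + d * g) * x` where `g` is the value of the formula. -/
structure Frame (K : Type) where
  a : ZMod 2
  b : ZMod 2
  c : ZMod 2
  d : ZMod 2
  F : BinaryFormula K

/-- The linear coefficient of a composition of frames. -/
def slope : List (Frame K) → (K → Bool) → ZMod 2
  | [], _ => 1
  | φ :: L, z => (φ.c + φ.d * φ.F.eval z) * slope L z

/-- The constant coefficient of a composition of frames. -/
def offset : List (Frame K) → (K → Bool) → ZMod 2
  | [], _ => 0
  | φ :: L, z => φ.a + φ.b * φ.F.eval z + (φ.c + φ.d * φ.F.eval z) * offset L z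

/-- The number of leaves in a list of frames. -/
def totalSize (L : List (Frame K)) : ℕ := (L.map fun φ => φ.F.size).sum

@[simp] theorem totalSize_cons (φ : Frame K) (L : List (Frame K)) :
    totalSize (φ :: L) = φ.F.size + totalSize L := by simp [totalSize]

@[simp] theorem totalSize_append (L L' : List (Frame K)) :
    totalSize (L ++ L') = totalSize L + totalSize L' := by simp [totalSize]

theorem slope_append (L L' : List (Frame K)) (z : K → Bool) :
    slope (L ++ L') z = slope L z * slope L' z := by
  induction L with
  | nil => simp [slope]
  | cons φ L ih => simp [slope, ih, mul_assoc]

theorem offset_append (L L' : List (Frame K)) (z : K → Bool) :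
    offset (L ++ L') z = offset L z + slope L z * offset L' z := by
  induction L with
  | nil => simp [slope, offset]
  | cons φ L ih => simp only [List.cons_append, slope, offset, ih]; ring

/-- The frame `φ` is the first one with which the running total exceeds `S`; at most `S` leaves
remain after it. -/
theorem exists_split {L : List (Frame K)} {S : ℕ} (hL : totalSize L ≤ 2 * S) (hS : S < totalSize L) :
    ∃ L₁ φ L₂, L = L₁ ++ φ :: L₂ ∧ totalSize L₁ ≤ S ∧ totalSize L₂ ≤ S := by
  -- Here `T` counts the leaves of the frames already passed.
  suffices ∀ T ≤ S, ∀ L : List (Frame K), totalSize L ≤ 2 * S - T → S - T < totalSize L →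
      ∃ L₁ φ L₂, L = L₁ ++ φ :: L₂ ∧ T + totalSize L₁ ≤ S ∧ totalSize L₂ ≤ S by
    simpa using this 0 (Nat.zero_le _) L (by simpa using hL) (by simpa using hS)
  clear hL hS L
  intro T hT L
  induction L generalizing T with
  | nil => intro _ h; simp [totalSize] at h
  | cons φ L ih =>
    intro h₁ h₂
    rw [totalSize_cons] at h₁ h₂
    by_cases h : S < T + φ.F.size
    · exact ⟨[], φ, L, rfl, by simpa [totalSize] using hT, by omega⟩
    · obtain ⟨L₁, ψ, L₂, rfl, h₃, h₄⟩ := ih (T + φ.F.size) (by omega) (by omega) (by omega)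
      exact ⟨φ :: L₁, ψ, L₂, rfl, by rw [totalSize_cons]; omega, h₄⟩

/-- A formula decomposed along a path that always enters the larger subformula. -/
theorem BinaryFormula.exists_frames (F : BinaryFormula K) :
    ∃ L : List (Frame K), (∀ z, slope L z = 0 ∧ offset L z = F.eval z) ∧ totalSize L = F.size ∧
      ∀ φ ∈ L, 2 * φ.F.size ≤ F.size ∨ φ.F.size = 1 := by
  induction F with
  | var i =>
    -- The leaf at the end of the path is a constant map, whence the slope 0.
    exact ⟨[⟨0, 1, 0, 0, var i⟩], fun z => by simp [slope, offset], by simp [totalSize],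
      fun φ hφ => by simp at hφ; simp [hφ, size]⟩
  | const a =>
    exact ⟨[⟨0, 1, 0, 0, const a⟩], fun z => by simp [slope, offset], by simp [totalSize],
      fun φ hφ => by simp at hφ; simp [hφ, size]⟩
  | gate a b c d F G hF hG =>
    obtain h | h := le_total G.size F.size
    · obtain ⟨L, h₁, h₂, h₃⟩ := hF
      refine ⟨⟨a, c, b, d, G⟩ :: L, fun z => ?_, ?_, fun φ hφ => ?_⟩
      · simp only [slope, offset, eval, h₁]; exact ⟨by ring, by ring⟩
      · simp [size, h₂, add_comm]
      · simp only [size]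
        obtain rfl | hφ := List.mem_cons.1 hφ
        · left; simp only; omega
        · have := h₃ φ hφ; omega
    · obtain ⟨L, h₁, h₂, h₃⟩ := hG
      refine ⟨⟨a, b, c, d, F⟩ :: L, fun z => ?_, ?_, fun φ hφ => ?_⟩
      · simp only [slope, offset, eval, h₁]; exact ⟨by ring, by ring⟩
      · simp [size, h₂]
      · simp only [size]
        obtain rfl | hφ := List.mem_cons.1 hφ
        · left; simp only; omega
        · have := h₃ φ hφ; omega

/-- A single frame may be too large to be split off. The formula inside it is decomposed along its
own heavy path, where every frame has at most half of its leaves or just one, so the middle frame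
`ψ` is small. -/
theorem exists_frames_of_frame (φ : Frame K) {S : ℕ} (hS : 1 ≤ S)
    (hφ : φ.F.size ≤ 2 * S) :
    ∃ L₁ ψ L₂, totalSize L₁ ≤ S ∧ ψ.F.size ≤ S ∧ totalSize L₂ ≤ S ∧
      totalSize (L₁ ++ ψ :: L₂) = φ.F.size ∧
      ∀ z, offset (L₁ ++ ψ :: L₂) z = φ.F.eval z := by
  obtain ⟨L, h₁, h₂, h₃⟩ := φ.F.exists_frames
  by_cases h : S < φ.F.size
  · obtain ⟨L₁, ψ, L₂, rfl, h₄, h₅⟩ := exists_split (L := L) (by rwa [h₂]) (by rwa [h₂])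
    refine ⟨L₁, ψ, L₂, h₄, ?_, h₅, h₂, fun z => (h₁ z).2⟩
    exact (h₃ ψ (by simp)).elim (by omega) fun h => h.trans_le hS
  · refine ⟨[], ⟨0, 1, 0, 0, φ.F⟩, [], by simp [totalSize], by simpa using h, by simp [totalSize],
      by simp [totalSize], fun z => by simp [offset]⟩

end BinaryFormula

/-! ### The number of reads per leaf -/

section Reads

variable {K ι : Type} [DecidableEq ι]

/-- The functions of all compositions of frames with at most `S` leaves can be produced on `k`
registers with `m` reads per leaf. -/
def PassBound (K ι : Type) [DecidableEq ι] (k m S : ℕ) : Prop :=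
  ∀ L : List (Frame K), totalSize L ≤ S → Pass ι k (slope L) (offset L) (m * totalSize L)

/-- The five pieces are `L₁`, `M₁`, `ψ`, `M₂`, `L₂`. Four compositions cost one register each and
the affine change costs two, hence `5 * k + 6`. Every leaf lies in exactly one piece, so the reads
per leaf do not increase. -/
theorem PassBound.double {k m S : ℕ} (h : PassBound K ι k m S) (hS : 1 ≤ S) :
    PassBound K ι (5 * k + 6) m (2 * S) := by
  intro L hL
  by_cases hLS : totalSize L ≤ S
  · exact (h L hLS).mono (by omega)
  obtain ⟨L₁, φ, L₂, rfl, h₁, h₂⟩ := exists_split hL (not_le.1 hLS)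
  rw [totalSize_append, totalSize_cons] at hL
  obtain ⟨M₁, ψ, M₂, k₁, k₂, k₃, e, he⟩ := exists_frames_of_frame φ hS (by omega)
  have hψ := h [ψ] (by simpa [totalSize] using k₂)
  -- The offset of `M₁ ++ ψ :: M₂` is the value of `φ.F`; the affine change converts it to the slope
  -- and the offset of the frame `φ`.
  have hM := ((h M₁ k₁).comp (hψ.comp (h M₂ k₃))).affine ![φ.c, 0, φ.d] ![φ.a, 0, φ.b]
  have := (h L₁ h₁).comp (hM.comp (h L₂ h₂))
  convert this.mono (show _ ≤ 5 * k + 6 by omega) using 1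
  · funext z
    have := he z
    simp only [offset_append, slope_append, slope, offset] at this ⊢
    rw [← this]
    simp
  · funext z
    have := he z
    simp only [offset_append, slope, offset] at this ⊢
    rw [← this]
    simp
  · rw [totalSize_append, totalSize_cons, ← e]
    simp [totalSize]
    ring

/-- The number of registers that suffices for `r` doublings. -/
def registers : ℕ → ℕ
  | 0 => 2
  | r + 1 => 5 * registers r + 6

/-- The functions of all compositions of frames with at most `S` leaves can be computed with `m`
reads per leaf. -/
def ReadBound (K ι : Type) [DecidableEq ι] (m S : ℕ) : Prop :=
  ∀ L : List (Frame K), totalSize L ≤ S → Computable ι (slope L) (offset L) (m * totalSize L)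

theorem ReadBound.one : ReadBound K ι 1 1 := by
  intro L hL
  match L with
  | [] => exact Computable.const 1 0 _
  | φ :: φ' :: L =>
    have := φ.F.one_le_size
    have := φ'.F.one_le_size
    simp at hL
    omega
  | [⟨a, b, c, d, F⟩] =>
    cases F with
    | var i =>
      convert Computable.read (ι := ι) i c d a b using 1
      · funext z; simp [slope, BinaryFormula.eval, bit]
      · funext z; simp [offset, BinaryFormula.eval, bit]
      · simp [totalSize, BinaryFormula.size]
    | const e =>
      convert Computable.const (K := K) (ι := ι) (c + d * e) (a + b * e) 1 using 1
      · funext z; simp [slope, BinaryFormula.eval]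
      · funext z; simp [offset, BinaryFormula.eval]
      · simp [totalSize, BinaryFormula.size]
    | gate _ _ _ _ F G =>
      have := F.one_le_size
      have := G.one_le_size
      simp [totalSize, BinaryFormula.size] at hL
      omega

/-- All `r` doublings are carried out with garbage, and a single cleaning at the end causes the
factor 4. -/
theorem ReadBound.pow_two_mul [Fintype ι] {m S : ℕ} (h : ReadBound K ι m S) (hS : 1 ≤ S) (r : ℕ)
    (hr : registers r + 4 ≤ Fintype.card ι) : ReadBound K ι (4 * m) (2 ^ r * S) := by
  have key : ∀ r, PassBound K ι (registers r) m (2 ^ r * S) := by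
    intro r
    induction r with
    | zero => intro L hL; exact (h L (by simpa using hL)).pass
    | succ r ih =>
      have := ih.double (hS.trans (Nat.le_mul_of_pos_left _ (by positivity)))
      rwa [← mul_assoc, ← pow_succ'] at this
  intro L hL
  rw [mul_assoc]
  exact (key r L hL).computable hr

theorem ReadBound.pow [Fintype ι] (r : ℕ) (hr : registers r + 4 ≤ Fintype.card ι) (l : ℕ) :
    ReadBound K ι (4 ^ l) (2 ^ (r * l)) := by
  induction l with
  | zero => simpa using ReadBound.one
  | succ l ih =>
    have := ih.pow_two_mul Nat.one_le_two_pow r hr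
    rwa [← pow_succ', ← pow_add, add_comm r, ← Nat.mul_succ] at this

theorem BinaryFormula.exists_program [Fintype ι] (r : ℕ) (hr : registers r + 4 ≤ Fintype.card ι)
    (l : ℕ) (F : BinaryFormula K) (hF : F.size ≤ 2 ^ (r * l)) {s t : ι} (hst : s ≠ t) :
    ∃ p : (K → Bool) → RegAut ι, Program p (4 ^ l * F.size) ∧
      ∀ z, p z (Pi.single s 1) = Pi.single s 1 + Pi.single t (F.eval z) := by
  obtain ⟨L, h₁, h₂, -⟩ := F.exists_frames
  obtain ⟨u, -, hu⟩ := Finset.exists_mem_notMem_of_card_lt_card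
    (show ({s, t} : Finset ι).card < Finset.univ.card by
      have := Finset.card_le_two (a := s) (b := t)
      rw [Finset.card_univ]; omega)
  simp only [Finset.mem_insert, Finset.mem_singleton, not_or] at hu
  obtain ⟨p, hp, h⟩ := ReadBound.pow r hr l L (h₂ ▸ hF) s t u hst (Ne.symm hu.1) (Ne.symm hu.2)
  exact ⟨p, h₂ ▸ hp, fun z => by simp [h, h₁]⟩

/-- The garden-hose complexity of a composition with a binary formula. -/
theorem BinaryFormula.GH_le {X Y : Type*} (r l : ℕ) (F : BinaryFormula K)
    (hF : F.size ≤ 2 ^ (r * l)) (g : (K → Bool) → Bool) (hg : ∀ z, F.eval z = bit (g z))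
    {f : K → X → Y → Bool} {c : ℕ} (hf : ∀ i, GH (f i) ≤ c) :
    GH (fun x y => g fun i => f i x y) ≤
      (4 ^ l * F.size * (2 * 2 ^ (registers r + 4) * (c + 1)) + 2 * 2 ^ (registers r + 4) + 2 : ℕ)
      := by
  have hst : (0 : Fin (registers r + 4)) ≠ 1 := by simp
  obtain ⟨p, hp, h⟩ := F.exists_program r (ι := Fin (registers r + 4)) (by simp) l hF hst
  -- The unit vector of register 0 is fixed exactly if the value added to register 1 is zero.
  have := hp.GH_le (Q := Fin (registers r + 4) → ZMod 2) hf g (Pi.single 0 1) (Pi.single 0 1) fun z => by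
    rw [LinearEquiv.smul_def, h, hg]
    cases g z <;> simp [bit]
  simpa [ZMod.card] using this

end Reads

/-! ### Conversion to binary formulas with the same number of leaves -/

section Conversion

variable {K : Type}

theorem BinaryFormula.exists_gate (op : Bool → Bool → Bool) (F G : BinaryFormula K)
    {f g : (K → Bool) → Bool} (hf : ∀ z, F.eval z = bit (f z)) (hg : ∀ z, G.eval z = bit (g z)) :
    ∃ H : BinaryFormula K, H.size = F.size + G.size ∧ ∀ z, H.eval z = bit (op (f z) (g z)) := by
  refine ⟨gate (bit (op false false)) (bit (op true false) + bit (op false false))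
    (bit (op false true) + bit (op false false))
    (bit (op true true) + bit (op true false) + bit (op false true) + bit (op false false)) F G,
    rfl, fun z => ?_⟩
  have key : ∀ p q r s x y : Bool, bit p + (bit q + bit p) * bit x + (bit r + bit p) * bit y +
      (bit s + bit q + bit r + bit p) * bit x * bit y =
        bit (bif x then (bif y then s else q) else (bif y then r else p)) := by decide
  rw [eval, hf, hg, key]
  cases f z <;> cases g z <;> rfl

/-- A gate of arbitrary fan-in that is an iterated gate of fan-in two. -/
theorem BinaryFormula.exists_fold (ψ : ∀ m, (Fin m → Bool) → Bool) (op : Bool → Bool → Bool)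
    (h₁ : ∀ x, ψ 1 x = x 0) (h₂ : ∀ m x, ψ (m + 2) x = op (x 0) (ψ (m + 1) fun i => x i.succ))
    {m : ℕ} (hm : 0 < m) (G : Fin m → BinaryFormula K) (g : Fin m → (K → Bool) → Bool)
    (hG : ∀ i z, (G i).eval z = bit (g i z)) :
    ∃ H : BinaryFormula K, H.size = ∑ i, (G i).size ∧
      ∀ z, H.eval z = bit (ψ m fun i => g i z) := by
  obtain ⟨m, rfl⟩ := Nat.exists_eq_add_one.2 hm
  clear hm
  induction m with
  | zero => exact ⟨G 0, by simp, fun z => by simp [h₁, hG]⟩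
  | succ m ih =>
    obtain ⟨H, hH, hH'⟩ := ih (fun i => G i.succ) (fun i => g i.succ) fun i => hG i.succ
    obtain ⟨H', h, h'⟩ := BinaryFormula.exists_gate op (G 0) H (hG 0) hH'
    exact ⟨H', by rw [h, hH, Fin.sum_univ_succ fun i => (G i).size], fun z => by rw [h', h₂]⟩

theorem andFun_succ (m : ℕ) (x : Fin (m + 1) → Bool) :
    andFun (m + 1) x = (x 0 && andFun m fun i => x i.succ) := by
  simp [andFun, Fin.forall_fin_succ, Bool.decide_and]

theorem orFun_succ (m : ℕ) (x : Fin (m + 1) → Bool) :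
    orFun (m + 1) x = (x 0 || orFun m fun i => x i.succ) := by
  simp [orFun, Fin.exists_fin_succ, Bool.decide_or]

theorem xorFun_succ (m : ℕ) (x : Fin (m + 1) → Bool) :
    xorFun (m + 1) x = (x 0 ^^ xorFun m fun i => x i.succ) := by
  unfold xorFun
  rw [Fin.card_filter_univ_succ]
  cases h : x 0
  · simp
  · simp [Nat.odd_add_one, -Nat.not_odd_iff_even]

theorem Formula.exists_binary_of_andOrXor (F : Formula K) (hF : F.IsOver andOrXor) :
    ∃ H : BinaryFormula K, H.size = F.size ∧ ∀ z, H.eval z = bit (F.eval z) := by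
  induction F with
  | var v => exact ⟨.var v, rfl, fun _ => rfl⟩
  | const b => exact ⟨.const (bit b), rfl, fun _ => rfl⟩
  | gate φ F ih =>
    obtain ⟨⟨m, hm, hφ⟩, hF⟩ := hF
    choose G hG hG' using fun i => ih i (hF i)
    simp only [Formula.size, Formula.eval, ← hG]
    rcases hφ with hφ | hφ | hφ <;> cases hφ
    · exact BinaryFormula.exists_fold andFun and (fun x => by simp [andFun])
        (fun m x => andFun_succ _ x) hm G (fun i => (F i).eval) hG'
    · exact BinaryFormula.exists_fold orFun or (fun x => by simp [orFun])
        (fun m x => orFun_succ _ x) hm G (fun i => (F i).eval) hG'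
    · exact BinaryFormula.exists_fold xorFun xor (fun x => by rw [xorFun_succ]; simp [xorFun])
        (fun m x => xorFun_succ _ x) hm G (fun i => (F i).eval) hG'

theorem Formula.exists_binary_of_fanInTwo (F : Formula K) (hF : F.IsOver fanInTwo) :
    ∃ H : BinaryFormula K, H.size = F.size ∧ ∀ z, H.eval z = bit (F.eval z) := by
  induction F with
  | var v => exact ⟨.var v, rfl, fun _ => rfl⟩
  | const b => exact ⟨.const (bit b), rfl, fun _ => rfl⟩
  | @gate m φ F ih =>
    obtain ⟨hm, hF⟩ := hF
    obtain rfl : m = 2 := hm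
    choose G hG hG' using fun i => ih i (hF i)
    obtain ⟨H, h, h'⟩ := BinaryFormula.exists_gate (fun x y => φ ![x, y]) (G 0) (G 1) (hG' 0) (hG' 1)
    refine ⟨H, by simp [h, hG, Formula.size], fun z => ?_⟩
    rw [h', Formula.eval]
    congr 2
    funext i
    fin_cases i <;> rfl

/-- AND, OR and XOR of positive fan-in preserve 0. This settles the case `c = 0`, where all inputs
are identically 0. -/
theorem Formula.eval_false {F : Formula K} (hF : F.IsOver andOrXor) (hc : F.NoConst) :
    F.eval (fun _ => false) = false := by
  induction F with
  | var v => rfl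
  | const b => exact hc.elim
  | gate φ F ih =>
    obtain ⟨⟨m, hm, hφ⟩, hF⟩ := hF
    have : (fun i => (F i).eval fun _ => false) = fun _ => false :=
      funext fun i => ih i (hF i) (hc i)
    rw [Formula.eval, this]
    rcases hφ with hφ | hφ | hφ <;> cases hφ
    · simpa [andFun] using ⟨⟨0, hm⟩⟩
    · simp [orFun]
    · simp [xorFun]

end Conversion

/-! ### Constants and single variables -/

section SmallProtocols

variable {X Y : Type*}

/-- The matching without edges. -/
def Matching.empty (V : Type) : Matching V := ⟨fun _ => none, by simp, by simp⟩

/-- The matching with a single edge. -/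
noncomputable def Matching.edge {V : Type} (a b : V) (h : a ≠ b) : Matching V :=
  Matching.ofRel (fun u v => (u = a ∧ v = b) ∨ (u = b ∧ v = a)) (by tauto)
    (by rintro u (⟨rfl, h'⟩ | ⟨rfl, h'⟩) <;> simp_all)
    (by rintro u v w (⟨rfl, rfl⟩ | ⟨rfl, rfl⟩) (⟨h₁, rfl⟩ | ⟨h₁, rfl⟩) <;> simp_all)

theorem Matching.edge_partner {V : Type} {a b : V} (h : a ≠ b) :
    (Matching.edge a b h).partner a = some b :=
  Matching.ofRel_partner.2 (Or.inl ⟨rfl, rfl⟩)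

theorem Matching.edge_partner_none {V : Type} {a b c : V} (h : a ≠ b) (ha : c ≠ a) (hb : c ≠ b) :
    (Matching.edge a b h).partner c = none :=
  Matching.ofRel_partner_none.2 (by tauto)

theorem GH_const_false : GH (fun (_ : X) (_ : Y) => false) = 0 := by
  have := GH_le_card (V := Empty) (f := fun (_ : X) (_ : Y) => false) (fun _ => .empty _)
    (fun _ => .empty _) fun x y => ⟨none, Flow.refl _, rfl⟩
  simpa using this

theorem eq_false_of_GH_le_zero {f : X → Y → Bool} (h : GH f ≤ 0) (x : X) (y : Y) :
    f x y = false := by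
  obtain ⟨s, hs, P, hP⟩ := GH_le_iff.1 (show GH f ≤ (0 : ℕ) from h)
  obtain rfl : s = 0 := by omega
  obtain ⟨n, ⟨hn, -⟩, hf⟩ := hP x y
  have h₁ : (P.alice x).partner none = none := by
    cases h : (P.alice x).partner none with
    | none => rfl
    | some v =>
      cases v with
      | none => exact ((P.alice x).irrefl _ h).elim
      | some v => exact v.elim0
  have h₂ : ∀ n, water (P.alice x) (P.bob y) (n + 1) = none := by
    intro n
    induction n with
    | zero => simp [water, h₁]
    | succ n ih => rw [water, ih]; rfl
  cases n with
  | zero => simpa using hf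
  | succ n => simp [h₂] at hn

theorem GH_alice_le (a : X → Bool) : GH (fun x (_ : Y) => a x) ≤ (2 : ℕ) := by
  have := GH_le_card (V := Bool) (f := fun x (_ : Y) => a x)
    (fun x => if a x then .edge none (some false) (by simp) else .empty _)
    (fun _ => .empty _) fun x y => ?_
  · simpa using this
  cases h : a x
  · exact ⟨none, Flow.refl _, by simp [Matching.empty]⟩
  · exact ⟨some false, Flow.alice (by simp [Matching.edge_partner]), rfl⟩

theorem GH_bob_le (b : Y → Bool) : GH (fun (_ : X) y => b y) ≤ (2 : ℕ) := by
  have := GH_le_card (V := Bool) (f := fun (_ : X) y => b y)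
    (fun _ => .edge none (some false) (by simp))
    (fun y => if b y then .empty _ else .edge false true (by simp)) fun x y => ?_
  · simpa using this
  have h₁ : ∀ MB, Flow (Matching.edge none (some false) (by simp)) MB (none, false)
      (some false, true) := fun _ => Flow.alice (Matching.edge_partner _)
  cases h : b y
  · refine ⟨some true, (h₁ _).trans (Flow.bob (Matching.extend_some ?_)), ?_⟩
    · simp [Matching.edge_partner]
    · exact Matching.edge_partner_none (by simp) (by simp) (by simp)
  · exact ⟨some false, h₁ _, by simp [Matching.extend, Matching.empty]⟩

theorem GH_split_var_le {V : Type} [DecidableEq V] (A : Finset V) (v : V) :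
    GH (split A fun z => z v) ≤ (2 : ℕ) := by
  by_cases h : v ∈ A
  · have : split A (fun z => z v) = fun x _ => x ⟨v, h⟩ := by funext x y; simp [split, h]
    exact this ▸ GH_alice_le _
  · have : split A (fun z => z v) = fun _ y => y ⟨v, h⟩ := by funext x y; simp [split, h]
    exact this ▸ GH_bob_le _

end SmallProtocols

/-! ### Choice of parameters and the asymptotic bounds -/

section Bounds

/-- For the least `l` with `s ≤ 2 ^ (r * l)`, if positive, `2 ^ (r * (l - 1)) < s`. As `2 ≤ ε * r`,
this gives `4 ^ (l - 1) ≤ s ^ ε`. -/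
theorem exists_pow_four_le {ε : ℝ} (hε : 0 < ε) {r : ℕ} (hr : 2 / ε ≤ r) {s : ℕ} (hs : 1 ≤ s) :
    ∃ l : ℕ, s ≤ 2 ^ (r * l) ∧ (4 : ℝ) ^ l ≤ 4 * (s : ℝ) ^ ε := by
  have hr₀ : (0 : ℝ) < r := (by positivity : (0 : ℝ) < 2 / ε).trans_le hr
  have hr₁ : 1 < 2 ^ r := Nat.one_lt_two_pow (by exact_mod_cast hr₀.ne')
  have hs₁ : (1 : ℝ) ≤ s := by exact_mod_cast hs
  refine ⟨Nat.clog (2 ^ r) s, pow_mul 2 r _ ▸ Nat.le_pow_clog hr₁ s, ?_⟩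
  cases hl : Nat.clog (2 ^ r) s with
  | zero =>
    have := Real.one_le_rpow hs₁ hε.le
    rw [pow_zero]
    linarith
  | succ l =>
    have h₁ : 2 ^ (r * l) < s := by
      rw [pow_mul]
      exact Nat.pow_lt_of_lt_clog (hl ▸ l.lt_succ_self)
    have h₂ : (4 : ℝ) ^ l ≤ (s : ℝ) ^ ε := by
      have h₃ : (2 : ℝ) ^ (r * l) ≤ s := by exact_mod_cast h₁.le
      have h₄ : (2 : ℝ) ≤ ε * r := by rwa [div_le_iff₀' hε] at hr
      calc (4 : ℝ) ^ l = (2 : ℝ) ^ (2 * (l : ℝ)) := by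
            rw [Real.rpow_mul (by norm_num), Real.rpow_natCast]; norm_num
        _ ≤ (2 : ℝ) ^ ((r * l : ℕ) * ε : ℝ) := by
            apply Real.rpow_le_rpow_of_exponent_le (by norm_num)
            push_cast
            nlinarith [(Nat.cast_nonneg l : (0 : ℝ) ≤ l)]
        _ = ((2 : ℝ) ^ (r * l)) ^ ε := by
            rw [Real.rpow_mul (by norm_num), Real.rpow_natCast]
        _ ≤ (s : ℝ) ^ ε := Real.rpow_le_rpow (by positivity) h₃ hε.le
    rw [pow_succ']
    linarith

theorem toENNReal_le_ofReal {a : ℕ∞} {n : ℕ} {r : ℝ} (h : a ≤ n) (hr : (n : ℝ) ≤ r) :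
    (a : ENNReal) ≤ ENNReal.ofReal r := by
  refine (ENat.toENNReal_le.2 h).trans ?_
  rw [ENat.toENNReal_coe, ← ENNReal.ofReal_natCast]
  exact ENNReal.ofReal_le_ofReal hr

theorem BinaryFormula.exists_GH_le (ε : ℝ) (hε : 0 < ε) :
    ∃ C : ℝ, 0 < C ∧ ∀ (X : Type*) (Y : Type*) (K : Type) (F : BinaryFormula K)
      (g : (K → Bool) → Bool) (f : K → X → Y → Bool) (c : ℕ), 1 ≤ c →
      (∀ z, F.eval z = bit (g z)) → (∀ i, GH (f i) ≤ (c : ℕ∞)) →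
      ((GH fun x y => g fun i => f i x y : ℕ∞) : ENNReal) ≤
        ENNReal.ofReal (C * (F.size : ℝ) ^ (1 + ε) * (c : ℝ)) := by
  set r := ⌈2 / ε⌉₊ with hr
  set q : ℕ := 2 * 2 ^ (registers r + 4) with hq
  -- The main term contributes `4 * 2 * q`, by `c + 1 ≤ 2 * c`; the additive terms `q` and 2 are
  -- absorbed because `T * c ≥ 1`.
  refine ⟨9 * q + 2, by positivity, fun X Y K F g f c hc hg hf => ?_⟩
  obtain ⟨l, hl, hl'⟩ := exists_pow_four_le hε (Nat.le_ceil (2 / ε)) F.one_le_size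
  refine toENNReal_le_ofReal (F.GH_le r l hl g hg hf) ?_
  rw [← hq]
  have hs : (1 : ℝ) ≤ F.size := by exact_mod_cast F.one_le_size
  have hc' : (1 : ℝ) ≤ c := by exact_mod_cast hc
  have h₁ : (4 : ℝ) ^ l * F.size ≤ 4 * (F.size : ℝ) ^ (1 + ε) := by
    rw [Real.rpow_add (by linarith), Real.rpow_one]
    nlinarith
  set T := (F.size : ℝ) ^ (1 + ε)
  have hT : 1 ≤ T := Real.one_le_rpow hs (by linarith)
  have hTc : 1 ≤ T * c := one_le_mul_of_one_le_of_one_le hT hc'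
  push_cast
  calc (4 : ℝ) ^ l * F.size * (q * (c + 1)) + q + 2
      ≤ 4 * T * (q * (c + c)) + q * (T * c) + 2 * (T * c) := by
        gcongr
        · nlinarith [(Nat.cast_nonneg q : (0 : ℝ) ≤ q)]
        · linarith
    _ = (9 * q + 2) * T * c := by ring

theorem ofReal_le_formulaSize {V : Type} {B : Set Gate} {g : (V → Bool) → Bool} {r : ℝ}
    (h : ∀ F : Formula V, F.IsOver B → F.Computes g → r ≤ F.size) :
    ENNReal.ofReal r ≤ ((formulaSize B g : ℕ∞) : ENNReal) := by
  have : ((⌈r⌉₊ : ℕ) : ℕ∞) ≤ formulaSize B g :=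
    le_iInf₂ fun F hF => Nat.cast_le.2 (Nat.ceil_le.2 (h F hF.1 hF.2))
  refine le_trans ?_ (ENat.toENNReal_le.2 this)
  rw [ENat.toENNReal_coe, ← ENNReal.ofReal_natCast]
  exact ENNReal.ofReal_le_ofReal (Nat.le_ceil r)

theorem exists_GH_le_of_andOrXor (ε : ℝ) (hε : 0 < ε) : ∃ C : ℝ, 0 < C ∧
    ∀ (X : Type*) (Y : Type*) (k : ℕ) (g : (Fin k → Bool) → Bool)
      (F : Formula (Fin k)) (c : ℕ) (f : Fin k → X → Y → Bool),
      F.IsOver andOrXor → F.Computes g → (F.NoConst ∨ 1 ≤ c) → (∀ i, GH (f i) ≤ (c : ℕ∞)) →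
      ((GH fun x y => g fun i => f i x y : ℕ∞) : ENNReal) ≤
        ENNReal.ofReal (C * (F.size : ℝ) ^ (1 + ε) * (c : ℝ)) := by
  obtain ⟨C, hC, h⟩ := BinaryFormula.exists_GH_le ε hε
  refine ⟨C, hC, fun X Y k g F c f hF hg hc hf => ?_⟩
  obtain rfl | hc' := Nat.eq_zero_or_pos c
  · have hc : F.NoConst := hc.resolve_right (by norm_num)
    have h₀ : (fun x y => g fun i => f i x y) = fun (_ : X) (_ : Y) => false := by
      funext x y
      have : (fun i => f i x y) = fun _ => false :=
        funext fun i => eq_false_of_GH_le_zero (hf i) x y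
      rw [this, ← hg, F.eval_false hF hc]
    rw [h₀, GH_const_false]
    simp
  · obtain ⟨H, hs, he⟩ := F.exists_binary_of_andOrXor hF
    rw [← hs]
    exact h X Y _ H g f c hc' (fun z => by rw [he, hg]) hf

theorem exists_GH_split_le (ε : ℝ) (hε : 0 < ε) : ∃ C : ℝ, 0 < C ∧
    ∀ (n : ℕ) (g : (Fin n → Bool) → Bool) (A : Finset (Fin n)) (F : Formula (Fin n)),
      F.IsOver fanInTwo → F.Computes g →
      ((GH (split A g) : ℕ∞) : ENNReal) ≤ ENNReal.ofReal (C * (F.size : ℝ) ^ (1 + ε)) := by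
  obtain ⟨C, hC, h⟩ := BinaryFormula.exists_GH_le ε hε
  -- A variable held by one player has garden-hose complexity at most 2, so the composition bound
  -- applies with `c = 2`.
  refine ⟨C * 2, by positivity, fun n g A F hF hg => ?_⟩
  obtain ⟨H, hs, he⟩ := F.exists_binary_of_fanInTwo hF
  have := h _ _ _ H g (fun v => split A fun z => z v) 2 one_le_two (fun z => by rw [he, hg])
    (GH_split_var_le A)
  rw [← hs, mul_right_comm]
  exact_mod_cast this

theorem exists_le_formulaSize (δ : ℝ) (hδ : 0 < δ) (hδ' : δ < 1) : ∃ b : ℝ, 0 < b ∧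
    ∀ (n : ℕ) (g : (Fin n → Bool) → Bool) (A : Finset (Fin n)) (t : ℝ), 0 ≤ t →
      ENNReal.ofReal t ≤ ((GH (split A g) : ℕ∞) : ENNReal) →
      ENNReal.ofReal (b * t ^ (1 - δ)) ≤ ((formulaSize fanInTwo g : ℕ∞) : ENNReal) := by
  have h₁ : 0 < 1 - δ := by linarith
  -- The exponent is chosen so that `(1 + δ / (1 - δ)) * (1 - δ) = 1`.
  obtain ⟨C, hC, h⟩ := exists_GH_split_le (δ / (1 - δ)) (by positivity)
  refine ⟨(C ^ (1 - δ))⁻¹, by positivity,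
    fun n g A t ht hg => ofReal_le_formulaSize fun F hF hF' => ?_⟩
  have h₂ := hg.trans (h n g A F hF hF')
  rw [ENNReal.ofReal_le_ofReal_iff (by positivity)] at h₂
  have h₃ := Real.rpow_le_rpow ht h₂ h₁.le
  rw [Real.mul_rpow hC.le (by positivity), ← Real.rpow_mul (by positivity)] at h₃
  have h₄ : (1 + δ / (1 - δ)) * (1 - δ) = 1 := by field_simp; ring
  rw [h₄, Real.rpow_one] at h₃
  rwa [inv_mul_le_iff₀ (by positivity)]

end Bounds

end GardenHose

/-! ### The main theorem -/

theorem mainTheorem4 :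
    -- composition with a formula over AND, OR, XOR gates
    (∀ ε : ℝ, 0 < ε → ∃ C : ℝ, 0 < C ∧
      ∀ (X : Type*) (Y : Type*) (k : ℕ) (g : (Fin k → Bool) → Bool)
        (F : GardenHose.Formula (Fin k)) (c : ℕ) (f : Fin k → X → Y → Bool),
        F.IsOver GardenHose.andOrXor → F.Computes g → (F.NoConst ∨ 1 ≤ c) →
        (∀ i, GardenHose.GH (f i) ≤ (c : ℕ∞)) →
        ((GardenHose.GH fun x y => g fun i => f i x y : ℕ∞) : ENNReal) ≤
          ENNReal.ofReal (C * (F.size : ℝ) ^ (1 + ε) * (c : ℝ))) ∧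
    -- formulas over all gates of fan-in 2, for any partition of the variables
    (∀ ε : ℝ, 0 < ε → ∃ C : ℝ, 0 < C ∧
      ∀ (n : ℕ) (g : (Fin n → Bool) → Bool) (A : Finset (Fin n)) (F : GardenHose.Formula (Fin n)),
        F.IsOver GardenHose.fanInTwo → F.Computes g →
        ((GardenHose.GH (GardenHose.split A g) : ℕ∞) : ENNReal) ≤
          ENNReal.ofReal (C * (F.size : ℝ) ^ (1 + ε))) ∧
    -- a lower bound on GH yields a slightly smaller lower bound on formula size
    (∀ δ : ℝ, 0 < δ → δ < 1 → ∃ b : ℝ, 0 < b ∧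
      ∀ (n : ℕ) (g : (Fin n → Bool) → Bool) (A : Finset (Fin n)) (t : ℝ), 0 ≤ t →
        ENNReal.ofReal t ≤ ((GardenHose.GH (GardenHose.split A g) : ℕ∞) : ENNReal) →
        ENNReal.ofReal (b * t ^ (1 - δ)) ≤
          ((GardenHose.formulaSize GardenHose.fanInTwo g : ℕ∞) : ENNReal)) ∧
    -- in particular for lower bounds of the order `n ^ (2 + ε)`
    (∀ ε δ : ℝ, 0 < δ → δ < ε →
      ∀ (m : ℕ → ℕ) (g : (n : ℕ) → (Fin (m n) → Bool) → Bool)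
        (A : (n : ℕ) → Finset (Fin (m n))),
        (∃ a : ℝ, 0 < a ∧ ∀ᶠ n : ℕ in Filter.atTop, ENNReal.ofReal (a * (n : ℝ) ^ (2 + ε)) ≤
          ((GardenHose.GH (GardenHose.split (A n) (g n)) : ℕ∞) : ENNReal)) →
        ∃ b : ℝ, 0 < b ∧ ∀ᶠ n : ℕ in Filter.atTop, ENNReal.ofReal (b * (n : ℝ) ^ (2 + δ)) ≤
          ((GardenHose.formulaSize GardenHose.fanInTwo (g n) : ℕ∞) : ENNReal)) := by
  refine ⟨GardenHose.exists_GH_le_of_andOrXor, GardenHose.exists_GH_split_le,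
    GardenHose.exists_le_formulaSize, fun ε δ hδ hδε m g A ⟨a, ha, h⟩ => ?_⟩
  have hε : 0 < 2 + ε := by linarith
  have h₁ : (ε - δ) / (2 + ε) < 1 := by rw [div_lt_one hε]; linarith
  -- This loss in the exponent turns `2 + ε` into exactly `2 + δ`.
  obtain ⟨b, hb, hb'⟩ := GardenHose.exists_le_formulaSize ((ε - δ) / (2 + ε))
    (div_pos (by linarith) hε) h₁
  refine ⟨b * a ^ (1 - (ε - δ) / (2 + ε)), by positivity, h.mono fun n hn => ?_⟩
  have h₂ := hb' _ (g n) (A n) _ (by positivity) hn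
  rw [Real.mul_rpow ha.le (by positivity), ← Real.rpow_mul (by positivity), ← mul_assoc] at h₂
  have h₃ : (2 + ε) * (1 - (ε - δ) / (2 + ε)) = 2 + δ := by field_simp; ring
  rwa [h₃] at h₂
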